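/- Let $\Omega$ be a compact Hausdorff space and let $B(\Omega)$ be the space of all real-valued Borel functions on $\Omega$. Let $\|\cdot\|_X : B(\Omega)\to[0,\infty]$ be an admissible extended-value quasinorm, that is: (a) $\|f\|_X\le\|g\|_X$ whenever $|f|\le|g|$ pointwise; (b) $\|\alpha f\|_X=|\alpha|\,\|f\|_X$ for $\alpha\in\mathbb R$ (with $0\cdot\infty=0$); (c) there is a constant $C<\infty$ such that $\|f+g\|_X\le C(\|f\|_X+\|g\|_X)$ whenever $f,g\ge0$ have disjoint supports; (d) there is a strictly positive $u\in B(\Omega)$ with $0<\|u\|_X<\infty$; (e) if $0\le f_n\uparrow f$ pointwise, with $f_n,f\in B(\Omega)$, then $\|f_n\|_X\to\|f\|_X$. Let $X=\{f\in B(\Omega):\|f\|_X<\infty\}$ be the associated quasi-Banach function space, and let $p,q\in(0,\infty)$. **Theorem 3.2.** Suppose that $X$ is $p$-normable, i.e. $\|\cdot\|_X$ is equivalent on $X$ to an absolutely homogeneous functional $P$ satisfying $P(f+g)^p\le P(f)^p+P(g)^p$, and that $X$ satisfies a crude lower $q$-estimate, i.e. there is a constant $b<\infty$ such that $\left(\sum_{i=1}^n\|f_i\|_X^q\right)^{1/q}\le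 b\,\|f_1+\dots+f_n\|_X$ for all $n$ and all $f_1,\dots,f_n\in X$ with pairwise disjoint supports (the support of $f$ is $\{f\neq0\}$). Then: (i) for every $0<r<p$, $X$ is $r$-convex: there is a constant $M<\infty$ such that $$\Big\|\Big(\sum_{i=1}^n|f_i|^r\Big)^{1/r}\Big\|_X\le M\Big(\sum_{i=1}^n\|f_i\|_X^r\Big)^{1/r}$$ for all $n$ and all $f_1,\dots,f_n\in X$; (ii) there is a finite (countably additive) Borel measure $\mu$ on $\Omega$ such that, for every $f\in B(\Omega)$, $\|f\|_X=0$ if and only if $f=0$ $\mu$-almost everywhere. -/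

import Mathlib

open scoped ENNReal NNReal Topology

/-- An admissible extended-value quasinorm on the space `B(Ω)` of all real-valued measurable
(for the Borel σ-algebra: Borel) functions on `Ω`. Only the values of `N` on measurable functions
are used, here and below. -/
structure IsAdmissibleQuasinorm {Ω : Type*} [MeasurableSpace Ω] (N : (Ω → ℝ) → ℝ≥0∞) : Prop where
  /-- Lattice monotonicity. -/
  mono : ∀ f g : Ω → ℝ, Measurable f → Measurable g → (∀ x, |f x| ≤ |g x|) → N f ≤ N g
  /-- Absolute homogeneity (with `0 * ∞ = 0`). -/
  smul : ∀ (a : ℝ) (f : Ω → ℝ), Measurable f → N (a • f) = ENNReal.ofReal |a| * N f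
  /-- Quasi-triangle inequality for nonnegative functions with disjoint supports. -/
  add_le : ∃ C : ℝ≥0, ∀ f g : Ω → ℝ, Measurable f → Measurable g →
    (∀ x, 0 ≤ f x) → (∀ x, 0 ≤ g x) →
    Disjoint (Function.support f) (Function.support g) → N (f + g) ≤ C * (N f + N g)
  /-- There is a strictly positive function of nonzero finite norm. -/
  exists_unit : ∃ u : Ω → ℝ, Measurable u ∧ (∀ x, 0 < u x) ∧ 0 < N u ∧ N u < ∞
  /-- Fatou property. -/
  fatou : ∀ (F : ℕ → Ω → ℝ) (f : Ω → ℝ), (∀ n, Measurable (F n)) → Measurable f →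
    (∀ n x, 0 ≤ F n x) → Monotone F → (∀ x, Filter.Tendsto (fun n => F n x) Filter.atTop (𝓝 (f x))) →
    Filter.Tendsto (fun n => N (F n)) Filter.atTop (𝓝 (N f))

/-- The quasi-Banach function space `X = {f ∈ B(Ω) : ‖f‖_X < ∞}` of the quasinorm `N = ‖·‖_X`
(functions are not identified when the norm of their difference is zero). -/
def functionSpace {Ω : Type*} [MeasurableSpace Ω] (N : (Ω → ℝ) → ℝ≥0∞) : Set (Ω → ℝ) :=
  {f | Measurable f ∧ N f < ∞}

/-- `X` is `p`-normable: its quasinorm is equivalent on `X` to a `p`-norm `P`, i.e. an absolutely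
homogeneous functional with `P (f + g) ^ p ≤ P f ^ p + P g ^ p`. -/
def IsPNormable {Ω : Type*} [MeasurableSpace Ω] (N : (Ω → ℝ) → ℝ≥0∞) (p : ℝ) : Prop :=
  ∃ P : (Ω → ℝ) → ℝ≥0∞,
    (∀ (a : ℝ), ∀ f ∈ functionSpace N, P (a • f) = ENNReal.ofReal |a| * P f) ∧
    (∀ f ∈ functionSpace N, ∀ g ∈ functionSpace N, P (f + g) ^ p ≤ P f ^ p + P g ^ p) ∧
    ∃ A : ℝ≥0, ∀ f ∈ functionSpace N, P f ≤ A * N f ∧ N f ≤ A * P f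

/-- `X` satisfies a crude lower `q`-estimate (with some constant `b`). -/
def HasCrudeLowerEstimate {Ω : Type*} [MeasurableSpace Ω] (N : (Ω → ℝ) → ℝ≥0∞) (q : ℝ) : Prop :=
  ∃ b : ℝ≥0, ∀ (n : ℕ) (f : Fin n → Ω → ℝ), (∀ i, f i ∈ functionSpace N) →
    (∀ i j, i ≠ j → Disjoint (Function.support (f i)) (Function.support (f j))) →
    (∑ i, N (f i) ^ q) ^ (1 / q) ≤ b * N (∑ i, f i)

/-- The `r`-convexity constant `M^(r)(X)`, possibly infinite. -/
noncomputable def convexityConstant {Ω : Type*} [MeasurableSpace Ω]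
    (N : (Ω → ℝ) → ℝ≥0∞) (r : ℝ) : ℝ≥0∞ :=
  sInf {M : ℝ≥0∞ | ∀ (n : ℕ) (f : Fin n → Ω → ℝ), (∀ i, f i ∈ functionSpace N) →
    N (fun x => (∑ i, |f i x| ^ r) ^ (1 / r)) ≤ M * (∑ i, N (f i) ^ r) ^ (1 / r)}

/-- `X` is `r`-convex if its `r`-convexity constant is finite. -/
def IsRConvex {Ω : Type*} [MeasurableSpace Ω] (N : (Ω → ℝ) → ℝ≥0∞) (r : ℝ) : Prop :=
  convexityConstant N r < ∞

/-!
For `g ∈ X` with `g ≥ 0` consider the set function `φ A = ‖g 1_A‖ ^ p` (`normPowOn`). It is monotone;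
`p`-normability makes it subadditive up to a constant `K`, and the crude lower `q`-estimate becomes a
lower `t`-estimate with `t = q / p`, for disjoint families
(`exists_isLowerSubmeasure_normPowOn`). None of the constants depends on `g`.

The heart of the matter is that such a `φ` is not pathological
(`IsLowerSubmeasure.exists_le_sum_of_one_le`): there is `c > 0`, depending only on `K`, `t` and the
constant of the lower estimate, such that `∑ w i * φ (A i) ≥ c * φ Ω` whenever
`∑ w i • 1_{A i} ≥ 1`. This is the combinatorial argument of Kalton and Roberts for uniformly
exhaustive submeasures. If each point lies in at least `M` of `n` sets, the union of a large constant
times `n / M` randomly chosen ones misses a given point only with small probability. So it suffices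
to bound `∑ φ (U i)` for a family in which each point lies in a small proportion of the sets
(`IsLowerSubmeasure.sum_le_of_multiplicity`). A bipartite graph of degree `3` with far fewer outputs
than inputs, in which every small set of inputs can be matched into the outputs
(`exists_concentrator`, by counting and Hall's theorem), cuts each `U i` into at most three pieces
`F i w`, in such a way that for each output `w` the pieces `F i w` are disjoint. The lower estimate
then bounds their sum.

Convexity (`isRConvex_of_lt`): put `g = (∑ |f i| ^ r) ^ (1 / r)` and suppose that
`‖f i‖ ^ r ≤ a i * ‖g‖ ^ r`. The sets `{|f i| ^ r ≥ 2 ^ k * a i * g ^ r}`, weighted by a multiple of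
`2 ^ k * a i`, cover `Ω` unless `∑ a i ≥ 1 / 2`, and `φ` of such a set is at most
`2 ^ (-k p / r) * ‖g‖ ^ p`. As `p > r`, the geometric series in `k` converges, and the covering
inequality gives a lower bound for `∑ a i`.

Control measure (`exists_control_measure`): by the covering inequality and the Hahn–Banach theorem
there is a finitely additive `μ ≤ φ` with `μ Ω ≥ c * φ Ω`. The Fatou property and the lower estimate
make `φ` continuous at `∅`, so that `μ` is countably additive. Doing this for
`g = u 1_S`, with `u > 0` of finite norm and `S` any measurable set, and exhausting yields countably
many measures whose common null sets are those of `A ↦ ‖u 1_A‖ ^ p`.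
-/

open MeasureTheory

/-! ### Concentrators -/

theorem Nat.pow_self_le_three_pow_mul_factorial (k : ℕ) :
    (k : ℝ) ^ k ≤ 3 ^ k * (k.factorial : ℝ) := by
  have h1 : (k : ℝ) ^ k / k.factorial ≤ Real.exp k :=
    Real.pow_div_factorial_le_exp (k : ℝ) (Nat.cast_nonneg k) k
  have h2 : Real.exp k ≤ 3 ^ k := by
    rw [← Real.exp_one_pow]
    exact pow_le_pow_left₀ (Real.exp_pos 1).le (by linarith [Real.exp_one_lt_d9]) k
  have h3 : (0 : ℝ) < k.factorial := by exact_mod_cast k.factorial_pos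
  exact (div_le_iff₀ h3).1 (h1.trans h2)

theorem Nat.choose_mul_pow_self_le (n k : ℕ) :
    (n.choose k : ℝ) * (k : ℝ) ^ k ≤ (3 * n : ℝ) ^ k := by
  have h1 : (n.choose k : ℝ) ≤ (n : ℝ) ^ k / k.factorial := Nat.choose_le_pow_div k n
  have h3 : (0 : ℝ) < k.factorial := by exact_mod_cast k.factorial_pos
  calc (n.choose k : ℝ) * (k : ℝ) ^ k
      ≤ (n : ℝ) ^ k / k.factorial * (3 ^ k * (k.factorial : ℝ)) := by
        gcongr
        exact Nat.pow_self_le_three_pow_mul_factorial k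
    _ = (3 * n : ℝ) ^ k := by field_simp; rw [mul_pow, mul_comm]

theorem sum_Icc_one_fourth_pow_lt_one (m : ℕ) :
    ∑ k ∈ Finset.Icc 1 m, (1 / 4 : ℝ) ^ k < 1 := by
  have h : ∀ m : ℕ, ∑ k ∈ Finset.Icc 1 m, (1 / 4 : ℝ) ^ k ≤ (1 - (1 / 4 : ℝ) ^ m) / 3 := by
    intro m
    induction m with
    | zero => simp
    | succ m ih =>
      rw [Finset.sum_Icc_succ_top (by omega)]
      have := pow_succ (1 / 4 : ℝ) m
      linarith
  have h1 := h m
  have h2 : (0 : ℝ) < (1 / 4) ^ m := by positivity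
  linarith

/-- Existence of a concentrator: a bipartite graph of degree at most `3` from `V` to `W` (vertex `v`
is joined to `g v 0`, `g v 1`, `g v 2`) that satisfies Hall's condition for all sets of at most `m`
vertices, although `V` may be larger than `W` by any fixed factor. The graphs that violate the
condition at some `S` of size `k` send `S` into some `T` of size `k`; there are at most
`(1 / 4) ^ k * |W| ^ (3 |V|)` of these, which sums to less than the number of all graphs. -/
theorem exists_concentrator {V W : Type*} [Fintype V] [Fintype W] [Nonempty W] [DecidableEq W]
    (m : ℕ) (h : 36 * Fintype.card V * m ≤ Fintype.card W ^ 2) (hm : m ≤ Fintype.card W) :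
    ∃ g : V → Fin 3 → W, ∀ S : Finset V, S.card ≤ m →
      S.card ≤ (S.biUnion fun v => Finset.univ.image (g v)).card := by
  classical
  by_contra! hbad
  set L := Fintype.card V with hL
  set R := Fintype.card W with hR
  have hR0 : 0 < R := Fintype.card_pos
  let box : Finset V → Finset W → Finset (V → Fin 3 → W) := fun S T =>
    Fintype.piFinset fun v => if v ∈ S then Fintype.piFinset fun _ => T else Finset.univ
  have hcover : (Finset.univ : Finset (V → Fin 3 → W)) ⊆
      (Finset.Icc 1 m).biUnion fun k => (Finset.powersetCard k Finset.univ).biUnion fun S =>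
        (Finset.powersetCard k Finset.univ).biUnion fun T => box S T := by
    intro g _
    obtain ⟨S, hSm, hS⟩ := hbad g
    obtain ⟨T, hT, hTc⟩ := Finset.exists_superset_card_eq hS.le (hSm.trans hm)
    simp only [Finset.mem_biUnion, Finset.mem_Icc, Finset.mem_powersetCard_univ]
    refine ⟨S.card, ⟨by omega, hSm⟩, S, rfl, T, hTc, ?_⟩
    simp only [box, Fintype.mem_piFinset]
    intro v
    split_ifs with hv
    · rw [Fintype.mem_piFinset]
      intro l
      exact hT (Finset.mem_biUnion.2 ⟨v, hv, Finset.mem_image_of_mem _ (Finset.mem_univ l)⟩)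
    · exact Finset.mem_univ _
  have hbox : ∀ k, ∀ S ∈ Finset.powersetCard k (Finset.univ : Finset V),
      ∀ T ∈ Finset.powersetCard k (Finset.univ : Finset W),
      (box S T).card = (k ^ 3) ^ k * (R ^ 3) ^ (L - k) := by
    intro k S hS T hT
    rw [Finset.mem_powersetCard_univ] at hS hT
    have : ∀ v, (if v ∈ S then Fintype.piFinset fun _ : Fin 3 => T else Finset.univ).card
        = if v ∈ S then k ^ 3 else R ^ 3 := by
      intro v
      split_ifs <;> simp [hT, hR]
    simp only [box, Fintype.card_piFinset, this]
    rw [Finset.prod_ite]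
    simp only [Finset.prod_const]
    congr 2
    · rw [← hS]; congr 1; ext; simp
    · rw [← Finset.compl_filter, Finset.card_compl, ← hS]; congr 2; ext; simp
  have hcount : (R ^ 3) ^ L ≤ ∑ k ∈ Finset.Icc 1 m,
      L.choose k * (R.choose k * ((k ^ 3) ^ k * (R ^ 3) ^ (L - k))) := by
    have h1 := Finset.card_le_card hcover
    have h0 : (Finset.univ : Finset (V → Fin 3 → W)).card = (R ^ 3) ^ L := by
      simp [hR, hL]
    rw [h0] at h1
    refine h1.trans (Finset.card_biUnion_le.trans (Finset.sum_le_sum fun k _ => ?_))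
    have e1 : (Finset.powersetCard k (Finset.univ : Finset V)).card = L.choose k := by simp [hL]
    have e2 : (Finset.powersetCard k (Finset.univ : Finset W)).card = R.choose k := by simp [hR]
    rw [← e1, ← e2]
    refine Finset.card_biUnion_le_card_mul _ _ _ fun S hS => ?_
    exact Finset.card_biUnion_le_card_mul _ _ _ fun T hT => (hbox k S hS T hT).le
  have hterm : ∀ k ∈ Finset.Icc 1 m,
      ((L.choose k * (R.choose k * ((k ^ 3) ^ k * (R ^ 3) ^ (L - k))) : ℕ) : ℝ)
        ≤ (1 / 4 : ℝ) ^ k * ((R : ℝ) ^ 3) ^ L := by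
    intro k hk
    rw [Finset.mem_Icc] at hk
    rcases lt_or_ge L k with hLk | hkL
    · rw [Nat.choose_eq_zero_of_lt hLk]
      simp only [zero_mul, Nat.cast_zero]
      positivity
    · have hLkR : 36 * (L : ℝ) * k ≤ (R : ℝ) ^ 2 := by
        have : 36 * L * k ≤ R ^ 2 := le_trans (Nat.mul_le_mul_left _ hk.2) h
        exact_mod_cast this
      have e : ((R : ℝ) ^ 3) ^ L = ((R : ℝ) ^ 3) ^ k * ((R : ℝ) ^ 3) ^ (L - k) := by
        rw [← pow_add]; congr 1; omega
      push_cast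
      rw [e]
      have key : (L.choose k : ℝ) * (k : ℝ) ^ k * ((R.choose k : ℝ) * (k : ℝ) ^ k) * (k : ℝ) ^ k
          ≤ (1 / 4 : ℝ) ^ k * ((R : ℝ) ^ 3) ^ k := by
        calc _ ≤ (3 * L : ℝ) ^ k * (3 * R : ℝ) ^ k * (k : ℝ) ^ k := by
              gcongr
              · exact Nat.choose_mul_pow_self_le L k
              · exact Nat.choose_mul_pow_self_le R k
          _ = (9 * L * k * R : ℝ) ^ k := by rw [← mul_pow, ← mul_pow]; congr 1; ring
          _ ≤ (1 / 4 * (R : ℝ) ^ 3) ^ k := by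
              refine pow_le_pow_left₀ (by positivity) ?_ k
              have : (0 : ℝ) ≤ R := Nat.cast_nonneg R
              nlinarith
          _ = _ := mul_pow _ _ _
      calc _ = (L.choose k : ℝ) * (k : ℝ) ^ k * ((R.choose k : ℝ) * (k : ℝ) ^ k) * (k : ℝ) ^ k
              * ((R : ℝ) ^ 3) ^ (L - k) := by rw [← pow_mul, mul_comm 3 k, pow_mul]; ring
        _ ≤ (1 / 4 : ℝ) ^ k * ((R : ℝ) ^ 3) ^ k * ((R : ℝ) ^ 3) ^ (L - k) :=
            mul_le_mul_of_nonneg_right key (by positivity)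
        _ = _ := by ring
  have hfin : ((R : ℝ) ^ 3) ^ L ≤ (∑ k ∈ Finset.Icc 1 m, (1 / 4 : ℝ) ^ k) * ((R : ℝ) ^ 3) ^ L := by
    have h1 : (((R ^ 3) ^ L : ℕ) : ℝ) ≤ ((∑ k ∈ Finset.Icc 1 m,
      L.choose k * (R.choose k * ((k ^ 3) ^ k * (R ^ 3) ^ (L - k))) : ℕ) : ℝ) := by
      exact_mod_cast hcount
    rw [Nat.cast_sum] at h1
    rw [Finset.sum_mul]
    push_cast at h1 ⊢
    refine h1.trans (Finset.sum_le_sum fun k hk => ?_)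
    have := hterm k hk
    push_cast at this
    exact this
  have hpos : 0 < ((R : ℝ) ^ 3) ^ L := by positivity
  have := sum_Icc_one_fourth_pow_lt_one m
  nlinarith

/-! ### Set functions with a lower estimate: families of small multiplicity -/

/-- Hall's theorem for a subset `S` of the vertices, with a matching defined on all vertices. -/
theorem exists_injOn_of_card_le_biUnion {V W : Type*} [Fintype V] [DecidableEq W] [Nonempty W]
    {N : V → Finset W} {S : Finset V} (h : ∀ T ⊆ S, T.card ≤ (T.biUnion N).card) :
    ∃ f : V → W, Set.InjOn f S ∧ ∀ v ∈ S, f v ∈ N v := by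
  classical
  have hall := (Finset.all_card_le_biUnion_card_iff_exists_injective (fun v : S => N v)).1 (by
    intro T
    have h1 := h (T.map (Function.Embedding.subtype _)) (by
      intro v hv
      obtain ⟨a, _, rfl⟩ := Finset.mem_map.1 hv
      exact a.2)
    rw [Finset.card_map] at h1
    refine h1.trans (Finset.card_le_card ?_)
    intro w hw
    simp only [Finset.mem_biUnion, Finset.mem_map] at hw ⊢
    obtain ⟨_, ⟨a, ha, rfl⟩, hw⟩ := hw
    exact ⟨a, ha, hw⟩)
  obtain ⟨f, hf, hfN⟩ := hall
  refine ⟨fun v => if hv : v ∈ S then f ⟨v, hv⟩ else Classical.arbitrary W, ?_, ?_⟩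
  · intro a ha b hb hab
    have ha' : a ∈ S := ha
    have hb' : b ∈ S := hb
    simp only [ha', hb', dif_pos] at hab
    exact congrArg Subtype.val (hf hab)
  · intro v hv
    simp only [hv, dif_pos]
    exact hfN ⟨v, hv⟩

/-- A monotone set function `φ` that is subadditive up to the factor `K` and satisfies a lower
`t`-estimate, with constant `B`, for finite disjoint families (measured against the whole space).
Only its values on measurable sets are constrained, apart from nonnegativity. -/
structure IsLowerSubmeasure {Ω : Type*} [MeasurableSpace Ω] (φ : Set Ω → ℝ) (K B t : ℝ) :
    Prop where
  nonneg : ∀ A, 0 ≤ φ A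
  mono : ∀ A A', MeasurableSet A → MeasurableSet A' → A ⊆ A' → φ A ≤ φ A'
  biUnion_le : ∀ {ι : Type} (s : Finset ι) (A : ι → Set Ω), (∀ i ∈ s, MeasurableSet (A i)) →
    φ (⋃ i ∈ s, A i) ≤ K * ∑ i ∈ s, φ (A i)
  sum_rpow_le : ∀ {ι : Type} (s : Finset ι) (A : ι → Set Ω), (∀ i ∈ s, MeasurableSet (A i)) →
    (s : Set ι).PairwiseDisjoint A → ∑ i ∈ s, φ (A i) ^ t ≤ B * φ Set.univ ^ t

namespace IsLowerSubmeasure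

variable {Ω : Type*} [MeasurableSpace Ω] {φ : Set Ω → ℝ} {K B t : ℝ}

theorem le_univ (h : IsLowerSubmeasure φ K B t) {A : Set Ω} (hA : MeasurableSet A) :
    φ A ≤ φ Set.univ :=
  h.mono _ _ hA MeasurableSet.univ (Set.subset_univ _)

open Classical in
/-- If each point lies in a small proportion of the sets `U i`, then the average of `φ (U i)` is
small compared with `φ univ`. Here `e` is a threshold for `φ`, and `s` is the ratio of the numbers of
inputs and outputs of the concentrator used: taking `e` small and then `s` large makes the constant
as small as desired. -/
theorem sum_le_of_multiplicity (h : IsLowerSubmeasure φ K B t) (hK : 0 < K) (ht : 0 < t)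
    {e : ℝ} (he : 0 < e) {s : ℕ} (hs : 0 < s) {ι : Type} [Fintype ι]
    (U : ι → Set Ω) (hU : ∀ i, MeasurableSet (U i))
    (hmult : ∀ x, 36 * s ^ 2 * (Finset.univ.filter fun i => x ∈ U i).card ≤ Fintype.card ι) :
    ∑ i, φ (U i) ≤ K * (3 * e + B * e ^ (-t) / s) * Fintype.card ι * φ Set.univ := by
  rcases isEmpty_or_nonempty ι with hι | hι
  · simp
  rcases (h.nonneg Set.univ).eq_or_lt with hc | hc
  · rw [← hc, mul_zero]
    exact Finset.sum_nonpos fun i _ => (h.le_univ (hU i)).trans hc.symm.le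
  set c := φ Set.univ with hcdef
  set R := Fintype.card ι with hR
  set m := R / (36 * s) with hm
  have hcardV : Fintype.card (ι × Fin s) = R * s := by simp [hR]
  have hmR : 36 * s * m ≤ R := Nat.mul_div_le R (36 * s)
  obtain ⟨g, hg⟩ := exists_concentrator (V := ι × Fin s) (W := ι) m
    (by rw [hcardV]; nlinarith) (Nat.div_le_self _ _)
  -- The inputs `ι × Fin s` are `s` copies of the sets, the outputs are indexed by `ι`. The set `S x`
  -- of the copies that contain `x` is matched into the outputs by `f (S x)`.
  let S : Ω → Finset (ι × Fin s) := fun x => Finset.univ.filter fun v => x ∈ U v.1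
  have hScard : ∀ x, (S x).card ≤ m := by
    intro x
    have : S x = (Finset.univ.filter fun i => x ∈ U i) ×ˢ (Finset.univ : Finset (Fin s)) := by
      ext v; simp [S]
    rw [this, Finset.card_product, Finset.card_univ, Fintype.card_fin, hm,
      Nat.le_div_iff_mul_le (by positivity)]
    have := hmult x
    nlinarith
  have hmatch : ∀ T : Finset (ι × Fin s), T.card ≤ m → ∃ f : ι × Fin s → ι, Set.InjOn f T ∧
      ∀ v ∈ T, f v ∈ Finset.univ.image (g v) := fun T hT =>
    exists_injOn_of_card_le_biUnion fun T' hT' => hg T' ((Finset.card_le_card hT').trans hT)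
  choose! f hfinj hfmem using hmatch
  let F : ι × Fin s → ι → Set Ω := fun v w => {x | x ∈ U v.1 ∧ f (S x) v = w}
  have hSmeas : ∀ T, MeasurableSet {x | S x = T} := by
    intro T
    have : {x | S x = T} = ⋂ v : ι × Fin s, {x | x ∈ U v.1 ↔ v ∈ T} := by
      ext x; simp [S, Finset.ext_iff]
    rw [this]
    refine MeasurableSet.iInter fun v => ?_
    by_cases hv : v ∈ T
    · simpa [hv] using hU v.1
    · simp only [hv, iff_false]
      exact (hU v.1).compl
  have hF : ∀ v w, MeasurableSet (F v w) := by
    intro v w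
    have : F v w = U v.1 ∩ ⋃ T : {T : Finset (ι × Fin s) // f T v = w}, {x | S x = T.1} := by
      ext x
      simp only [F, Set.mem_ofPred_eq, Set.mem_inter_iff, Set.mem_iUnion, Subtype.exists,
        exists_prop, exists_eq_right']
    rw [this]
    exact (hU v.1).inter (MeasurableSet.iUnion fun T => hSmeas T.1)
  have hUF : ∀ v : ι × Fin s, φ (U v.1) ≤ K * ∑ w ∈ Finset.univ.image (g v), φ (F v w) := by
    intro v
    have : U v.1 = ⋃ w ∈ Finset.univ.image (g v), F v w := by
      ext x
      simp only [F, Set.mem_iUnion, Set.mem_ofPred_eq]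
      constructor
      · intro hx
        exact ⟨f (S x) v, hfmem _ (hScard x) v (by simp [S, hx]), hx, rfl⟩
      · rintro ⟨w, _, hx, _⟩
        exact hx
    rw [this]
    exact h.biUnion_le _ _ fun w _ => hF v w
  have hdisj : ∀ w, ((Finset.univ : Finset (ι × Fin s)) : Set _).PairwiseDisjoint
      fun v => F v w := by
    intro w v _ v' _ hne
    refine Set.disjoint_left.2 ?_
    rintro x ⟨hx, hw⟩ ⟨hx', hw'⟩
    exact hne (hfinj (S x) (hScard x) (by simp [S, hx]) (by simp [S, hx']) (hw.trans hw'.symm))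
  -- Either `y ≤ e * c` or `1 ≤ (y / (e * c)) ^ t`.
  have hsplit : ∀ y, 0 ≤ y → y ≤ c → y ≤ e * c + c * e ^ (-t) * (y ^ t / c ^ t) := by
    intro y hy hyc
    rcases le_total y (e * c) with hye | hye
    · have : 0 ≤ c * e ^ (-t) * (y ^ t / c ^ t) := by positivity
      linarith
    · have h1 : 1 ≤ (y / (e * c)) ^ t :=
        Real.one_le_rpow ((one_le_div (by positivity)).2 hye) ht.le
      have h2 : (y / (e * c)) ^ t = e ^ (-t) * (y ^ t / c ^ t) := by
        rw [Real.div_rpow hy (by positivity), Real.mul_rpow he.le hc.le, Real.rpow_neg he.le]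
        field_simp
      rw [h2] at h1
      have : 0 ≤ e * c := by positivity
      nlinarith
  have hlow : ∀ w, ∑ v, c * e ^ (-t) * (φ (F v w) ^ t / c ^ t) ≤ B * e ^ (-t) * c := by
    intro w
    have h1 := h.sum_rpow_le Finset.univ (fun v => F v w) (fun v _ => hF v w) (hdisj w)
    rw [← Finset.mul_sum, ← Finset.sum_div]
    have hct : 0 < c ^ t := Real.rpow_pos_of_pos hc t
    have h2 := (div_le_iff₀ hct).2 h1
    calc _ ≤ c * e ^ (-t) * B := by gcongr
      _ = _ := by ring
  have hsum : (s : ℝ) * ∑ i, φ (U i) ≤ K * (3 * e * (R * s) * c + R * (B * e ^ (-t) * c)) := by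
    calc (s : ℝ) * ∑ i, φ (U i) = ∑ v : ι × Fin s, φ (U v.1) := by
          rw [Fintype.sum_prod_type, Finset.mul_sum]
          simp
      _ ≤ ∑ v : ι × Fin s, K * ∑ w ∈ Finset.univ.image (g v), φ (F v w) :=
          Finset.sum_le_sum fun v _ => hUF v
      _ = K * ∑ v : ι × Fin s, ∑ w ∈ Finset.univ.image (g v), φ (F v w) := by
          rw [Finset.mul_sum]
      _ ≤ K * ∑ v : ι × Fin s, (3 * e * c +
            ∑ w, c * e ^ (-t) * (φ (F v w) ^ t / c ^ t)) := by
          gcongr with v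
          calc _ ≤ ∑ w ∈ Finset.univ.image (g v),
                (e * c + c * e ^ (-t) * (φ (F v w) ^ t / c ^ t)) :=
                Finset.sum_le_sum fun w _ => hsplit _ (h.nonneg _) (h.le_univ (hF v w))
            _ = (Finset.univ.image (g v)).card * (e * c) + ∑ w ∈ Finset.univ.image (g v),
                c * e ^ (-t) * (φ (F v w) ^ t / c ^ t) := by
                rw [Finset.sum_add_distrib, Finset.sum_const, nsmul_eq_mul]
            _ ≤ 3 * (e * c) + ∑ w, c * e ^ (-t) * (φ (F v w) ^ t / c ^ t) := by
                gcongr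
                · have : (Finset.univ.image (g v)).card ≤ 3 :=
                    Finset.card_image_le.trans (by simp)
                  exact_mod_cast this
                · intro w _ _
                  have := h.nonneg (F v w)
                  positivity
                · exact Finset.subset_univ _
            _ = _ := by ring
      _ ≤ _ := by
          rw [Finset.sum_add_distrib, Finset.sum_const, Finset.sum_comm, Finset.card_univ,
            hcardV, nsmul_eq_mul]
          have := Finset.sum_le_sum fun w (_ : w ∈ (Finset.univ : Finset ι)) => hlow w
          rw [Finset.sum_const, Finset.card_univ, nsmul_eq_mul] at this
          push_cast
          refine mul_le_mul_of_nonneg_left (add_le_add (by linarith) this) hK.le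
  have hs' : (0 : ℝ) < s := by exact_mod_cast hs
  rw [← mul_le_mul_iff_right₀ hs']
  refine hsum.trans_eq ?_
  field_simp

end IsLowerSubmeasure

/-! ### The covering inequality -/

namespace IsLowerSubmeasure

variable {Ω : Type*} [MeasurableSpace Ω] {φ : Set Ω → ℝ} {K B t : ℝ}

theorem empty (h : IsLowerSubmeasure φ K B t) : φ ∅ = 0 := by
  have := h.biUnion_le (∅ : Finset ℕ) (fun _ => ∅) (by simp)
  simp only [Finset.notMem_empty, Set.iUnion_of_empty, Set.iUnion_empty, Finset.sum_empty,
    mul_zero] at this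
  exact le_antisymm this (h.nonneg _)

open Classical in
/-- The covering inequality for families of sets that contain each point at least `M` times. -/
theorem exists_le_sum_of_le_card (hK : 0 < K) (hB : 0 ≤ B) (ht : 0 < t) :
    ∃ c : ℝ, 0 < c ∧ ∀ φ : Set Ω → ℝ, IsLowerSubmeasure φ K B t →
      ∀ {ι : Type} [Fintype ι] (A : ι → Set Ω) (M : ℕ), (∀ i, MeasurableSet (A i)) → 0 < M →
      (∀ x, M ≤ (Finset.univ.filter fun i => x ∈ A i).card) →
      c * M * φ Set.univ ≤ ∑ i, φ (A i) := by
  set e : ℝ := 1 / (12 * K ^ 2) with he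
  have he0 : 0 < e := by positivity
  obtain ⟨s, hs⟩ := exists_nat_gt (4 * K ^ 2 * (B * e ^ (-t)))
  have hs0 : (0 : ℝ) < s := lt_of_le_of_lt (by positivity) hs
  have hs0' : 0 < s := by exact_mod_cast hs0
  have hγ : K * (K * (3 * e + B * e ^ (-t) / s)) ≤ 1 / 2 := by
    have h1 : K * K * (3 * e) = 1 / 4 := by rw [he]; field_simp; norm_num
    have h2 : K * K * (B * e ^ (-t) / s) ≤ 1 / 4 := by
      rw [← mul_div_assoc, div_le_iff₀ hs0]; linarith
    linarith
  set Λ : ℝ := Real.log (36 * s ^ 2) with hΛ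
  have hs1 : (1 : ℝ) ≤ s := by exact_mod_cast hs0'
  have hΛ0 : 0 ≤ Λ := Real.log_nonneg (by nlinarith)
  refine ⟨1 / (2 * K * (Λ + 1)), by positivity, ?_⟩
  intro φ h ι _ A M hA hM hmult
  have hAsum : 0 ≤ ∑ i, φ (A i) := Finset.sum_nonneg fun i _ => h.nonneg _
  rcases isEmpty_or_nonempty Ω with hΩ | ⟨⟨x₀⟩⟩
  · rw [Set.univ_eq_empty_iff.2 hΩ, h.empty]
    simpa using hAsum
  set n := Fintype.card ι with hn
  have hMn : M ≤ n := (hmult x₀).trans (Finset.card_le_univ _)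
  have hM0 : (0 : ℝ) < M := by exact_mod_cast hM
  have hMnR : (M : ℝ) ≤ n := by exact_mod_cast hMn
  have hn0 : (0 : ℝ) < n := hM0.trans_le hMnR
  set k := ⌈Λ * n / M⌉₊ with hk
  -- `k` is chosen so that a point lies in the complement of a union of `k` random sets with
  -- probability at most `(1 - M / n) ^ k ≤ exp (-Λ) = 1 / (36 * s ^ 2)`.
  let U : (Fin k → ι) → Set Ω := fun τ => (⋃ l, A (τ l))ᶜ
  have hU : ∀ τ, MeasurableSet (U τ) := fun τ => (MeasurableSet.iUnion fun l => hA _).compl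
  have hUmult : ∀ x, 36 * s ^ 2 * (Finset.univ.filter fun τ => x ∈ U τ).card
      ≤ Fintype.card (Fin k → ι) := by
    intro x
    have h1 : (Finset.univ.filter fun τ => x ∈ U τ)
        = Fintype.piFinset fun _ : Fin k => Finset.univ.filter fun i => ¬ x ∈ A i := by
      ext τ; simp [U]
    have h2 : (Finset.univ.filter fun i => x ∈ A i).card
        + (Finset.univ.filter fun i => ¬ x ∈ A i).card = n := by
      rw [Finset.card_filter_add_card_filter_not, Finset.card_univ]
    set n₀ := (Finset.univ.filter fun i => ¬ x ∈ A i).card with hn₀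
    have h3 : (n₀ : ℝ) ≤ n - M := by
      have h4 := hmult x
      have : M + n₀ ≤ n := by omega
      have : ((M + n₀ : ℕ) : ℝ) ≤ n := by exact_mod_cast this
      push_cast at this
      linarith
    rw [h1, Fintype.card_piFinset_const, Fintype.card_fun, Fintype.card_fin, ← hn, ← hn₀]
    have h5 : (n₀ : ℝ) ≤ Real.exp (-(M / n)) * n := by
      have h6 := Real.add_one_le_exp (-((M : ℝ) / n))
      calc (n₀ : ℝ) ≤ (-((M : ℝ) / n) + 1) * n := by field_simp; linarith
        _ ≤ _ := by gcongr
    have h7 : 36 * (s : ℝ) ^ 2 * (n₀ : ℝ) ^ k ≤ (n : ℝ) ^ k := by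
      have h8 : Real.exp (-(M / n)) ^ k ≤ Real.exp (-Λ) := by
        rw [← Real.exp_nat_mul]
        apply Real.exp_le_exp.2
        have : Λ * n / M ≤ k := Nat.le_ceil _
        rw [div_le_iff₀ hM0] at this
        rw [mul_neg, neg_le_neg_iff, ← mul_div_assoc, le_div_iff₀ hn0]
        exact this
      have h9 : Real.exp (-Λ) = (36 * (s : ℝ) ^ 2)⁻¹ := by
        rw [Real.exp_neg, hΛ, Real.exp_log (by positivity)]
      calc 36 * (s : ℝ) ^ 2 * (n₀ : ℝ) ^ k
          ≤ 36 * (s : ℝ) ^ 2 * (Real.exp (-(M / n)) * n) ^ k := by gcongr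
        _ = 36 * (s : ℝ) ^ 2 * (Real.exp (-(M / n)) ^ k * n ^ k) := by rw [mul_pow]
        _ ≤ 36 * (s : ℝ) ^ 2 * ((36 * (s : ℝ) ^ 2)⁻¹ * n ^ k) := by rw [← h9]; gcongr
        _ = _ := by field_simp
    exact_mod_cast h7
  have hUsum := h.sum_le_of_multiplicity hK ht he0 hs0' U hU
    fun x => by convert hUmult x
  rw [Fintype.card_fun, Fintype.card_fin, ← hn] at hUsum
  push_cast at hUsum
  have hone : ∀ τ : Fin k → ι, φ Set.univ ≤ K * (φ (U τ) + ∑ l, φ (A (τ l))) := by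
    intro τ
    have h1 := h.biUnion_le (Finset.univ : Finset (Option (Fin k)))
      (fun o => o.elim (U τ) fun l => A (τ l)) (by
        rintro (_ | l) _
        · exact hU τ
        · exact hA _)
    have h2 : (⋃ o ∈ (Finset.univ : Finset (Option (Fin k))),
        (o.elim (U τ) fun l => A (τ l) : Set Ω)) = Set.univ := by
      simp only [Finset.mem_univ, Set.iUnion_true, Set.iUnion_option, Option.elim, U]
      exact Set.compl_union_self _
    rw [h2, Fintype.sum_option] at h1
    exact h1
  have hApply : ∑ τ : Fin k → ι, ∑ l, φ (A (τ l)) = k * ((n : ℝ) ^ (k - 1) * ∑ i, φ (A i)) := by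
    rw [Finset.sum_comm]
    have : ∀ l : Fin k, ∑ τ : Fin k → ι, φ (A (τ l)) = (n : ℝ) ^ (k - 1) * ∑ i, φ (A i) := by
      intro l
      have := Fintype.sum_piFinset_apply (fun i => φ (A i)) (Finset.univ : Finset ι) l
      simpa [hn] using this
    simp [this]
  have htot : (n : ℝ) ^ k * φ Set.univ
      ≤ K * (∑ τ, φ (U τ) + k * ((n : ℝ) ^ (k - 1) * ∑ i, φ (A i))) := by
    have h1 := Finset.sum_le_sum fun τ (_ : τ ∈ (Finset.univ : Finset (Fin k → ι))) => hone τ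
    rw [← Finset.mul_sum, Finset.sum_add_distrib, hApply, Finset.sum_const, Finset.card_univ,
      Fintype.card_fun, Fintype.card_fin, nsmul_eq_mul] at h1
    push_cast at h1
    exact h1
  have hkn : (k : ℝ) * (n : ℝ) ^ (k - 1) * M ≤ (Λ + 1) * (n : ℝ) ^ k := by
    have h1 : (k : ℝ) * M ≤ (Λ + 1) * n := by
      have := Nat.ceil_lt_add_one (show 0 ≤ Λ * n / M by positivity)
      rw [← hk] at this
      have h2 : (k : ℝ) * M ≤ (Λ * n / M + 1) * M := by gcongr
      have h3 : (Λ * n / M + 1) * M = Λ * n + M := by field_simp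
      linarith
    rcases Nat.eq_zero_or_pos k with hk0 | hk0
    · rw [hk0]; simp; positivity
    · have h4 : (n : ℝ) ^ k = (n : ℝ) ^ (k - 1) * n := by
        rw [← pow_succ]; congr 1; omega
      have h5 : (0 : ℝ) ≤ (n : ℝ) ^ (k - 1) := by positivity
      rw [h4]
      nlinarith
  have hφ0 := h.nonneg Set.univ
  have hnk : (0 : ℝ) < (n : ℝ) ^ k := by positivity
  have h1 : K * ∑ τ, φ (U τ) ≤ 1 / 2 * ((n : ℝ) ^ k * φ Set.univ) := by
    calc K * ∑ τ, φ (U τ)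
        ≤ K * (K * (3 * e + B * e ^ (-t) / s) * (n : ℝ) ^ k * φ Set.univ) := by gcongr
      _ = K * (K * (3 * e + B * e ^ (-t) / s)) * ((n : ℝ) ^ k * φ Set.univ) := by ring
      _ ≤ _ := by gcongr
  have h2 : (n : ℝ) ^ k * φ Set.univ ≤ 2 * K * (k * (n : ℝ) ^ (k - 1)) * ∑ i, φ (A i) := by
    linarith
  have h3 : (n : ℝ) ^ k * (M * φ Set.univ)
      ≤ (n : ℝ) ^ k * (2 * K * (Λ + 1) * ∑ i, φ (A i)) := by
    calc (n : ℝ) ^ k * (M * φ Set.univ) = M * ((n : ℝ) ^ k * φ Set.univ) := by ring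
      _ ≤ M * (2 * K * (k * (n : ℝ) ^ (k - 1)) * ∑ i, φ (A i)) := by gcongr
      _ = 2 * K * ((k * (n : ℝ) ^ (k - 1)) * M) * ∑ i, φ (A i) := by ring
      _ ≤ 2 * K * ((Λ + 1) * (n : ℝ) ^ k) * ∑ i, φ (A i) := by gcongr
      _ = _ := by ring
  have h4 := le_of_mul_le_mul_left h3 hnk
  rw [mul_assoc, div_mul_eq_mul_div, div_le_iff₀ (by positivity)]
  linarith

/-- The covering inequality: `φ` is bounded below by the cost of fractional covers of the whole
space, up to a constant that depends only on `K`, `B` and `t`. -/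
theorem exists_le_sum_of_one_le (hK : 0 < K) (hB : 0 ≤ B) (ht : 0 < t) :
    ∃ c : ℝ, 0 < c ∧ ∀ φ : Set Ω → ℝ, IsLowerSubmeasure φ K B t →
      ∀ {ι : Type} [Fintype ι] (A : ι → Set Ω) (w : ι → ℝ), (∀ i, MeasurableSet (A i)) →
      (∀ i, 0 ≤ w i) → (∀ x, 1 ≤ ∑ i, (A i).indicator (fun _ => w i) x) →
      c * φ Set.univ ≤ ∑ i, w i * φ (A i) := by
  classical
  obtain ⟨c, hc, H⟩ := exists_le_sum_of_le_card (Ω := Ω) hK hB ht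
  refine ⟨c, hc, fun φ h ι _ A w hA hw hcov => ?_⟩
  -- The weight `w i` is approximated by `⌈w i * M⌉ / M`, that is by repeating the set `A i`.
  have key : ∀ M : ℕ, 0 < M →
      c * φ Set.univ ≤ ∑ i, w i * φ (A i) + (∑ i, φ (A i)) * (1 / (M : ℝ)) := by
    intro M hM
    have hM0 : (0 : ℝ) < M := by exact_mod_cast hM
    have h1 := H φ h (ι := Σ i, Fin ⌈w i * M⌉₊) (fun j => A j.1) M (fun j => hA _) hM (by
      intro x
      have h2 : (Finset.univ.filter fun j : Σ i, Fin ⌈w i * M⌉₊ => x ∈ A j.1)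
          = (Finset.univ.filter fun i => x ∈ A i).sigma fun _ => Finset.univ := by
        ext j; simp
      rw [h2, Finset.card_sigma]
      simp only [Finset.card_univ, Fintype.card_fin]
      have h3 := hcov x
      have h4 : (M : ℝ) ≤ ∑ i ∈ Finset.univ.filter (fun i => x ∈ A i), (⌈w i * M⌉₊ : ℝ) := by
        calc (M : ℝ) = 1 * M := (one_mul _).symm
          _ ≤ (∑ i, (A i).indicator (fun _ => w i) x) * M := by gcongr
          _ = ∑ i ∈ Finset.univ.filter (fun i => x ∈ A i), w i * M := by
              rw [Finset.sum_filter, Finset.sum_mul]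
              refine Finset.sum_congr rfl fun i _ => ?_
              by_cases hx : x ∈ A i <;> simp [hx]
          _ ≤ _ := Finset.sum_le_sum fun i _ => Nat.le_ceil _
      exact_mod_cast h4)
    rw [Fintype.sum_sigma] at h1
    simp only [Finset.sum_const, Finset.card_univ, Fintype.card_fin, nsmul_eq_mul] at h1
    have h5 : ∑ i, (⌈w i * M⌉₊ : ℝ) * φ (A i) ≤ ∑ i, (w i * M + 1) * φ (A i) := by
      refine Finset.sum_le_sum fun i _ => mul_le_mul_of_nonneg_right ?_ (h.nonneg _)
      exact (Nat.ceil_lt_add_one (mul_nonneg (hw i) hM0.le)).le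
    have h6 : ∑ i, (w i * M + 1) * φ (A i)
        = (∑ i, w i * φ (A i) + (∑ i, φ (A i)) * (1 / (M : ℝ))) * M := by
      rw [add_mul, mul_assoc, one_div_mul_cancel hM0.ne', mul_one, Finset.sum_mul,
        ← Finset.sum_add_distrib]
      exact Finset.sum_congr rfl fun i _ => by ring
    have h7 : c * φ Set.univ * M
        ≤ (∑ i, w i * φ (A i) + (∑ i, φ (A i)) * (1 / (M : ℝ))) * M := by linarith
    exact le_of_mul_le_mul_right h7 hM0
  have hlim : Filter.Tendsto (fun M : ℕ => ∑ i, w i * φ (A i) + (∑ i, φ (A i)) * (1 / (M : ℝ)))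
      Filter.atTop (𝓝 (∑ i, w i * φ (A i) + (∑ i, φ (A i)) * 0)) :=
    (tendsto_one_div_atTop_nhds_zero_nat.const_mul _).const_add _
  rw [mul_zero, add_zero] at hlim
  exact ge_of_tendsto hlim (Filter.eventually_atTop.2 ⟨1, fun M hM => key M hM⟩)

end IsLowerSubmeasure

/-! ### The set function of a quasinorm -/

namespace IsAdmissibleQuasinorm

variable {Ω : Type*} [MeasurableSpace Ω] {N : (Ω → ℝ) → ℝ≥0∞} {p q : ℝ}

theorem map_zero (hN : IsAdmissibleQuasinorm N) : N 0 = 0 := by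
  have := hN.smul 0 0 measurable_zero
  simpa using this

theorem smul_lt_top (hN : IsAdmissibleQuasinorm N) (a : ℝ) {f : Ω → ℝ}
    (hf : f ∈ functionSpace N) : N (a • f) < ∞ := by
  rw [hN.smul a f hf.1]
  exact ENNReal.mul_lt_top ENNReal.ofReal_lt_top hf.2

theorem mem_of_abs_le (hN : IsAdmissibleQuasinorm N) {f g : Ω → ℝ} (hf : Measurable f)
    (hg : g ∈ functionSpace N) (h : ∀ x, |f x| ≤ |g x|) : f ∈ functionSpace N :=
  ⟨hf, (hN.mono f g hf hg.1 h).trans_lt hg.2⟩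

theorem indicator_le (hN : IsAdmissibleQuasinorm N) {g : Ω → ℝ} (hg : Measurable g) {A : Set Ω}
    (hA : MeasurableSet A) : N (A.indicator g) ≤ N g := by
  refine hN.mono _ _ (hg.indicator hA) hg fun x => ?_
  by_cases hx : x ∈ A <;> simp [hx]

theorem indicator_mem (hN : IsAdmissibleQuasinorm N) {g : Ω → ℝ} (hg : g ∈ functionSpace N)
    {A : Set Ω} (hA : MeasurableSet A) : A.indicator g ∈ functionSpace N :=
  ⟨hg.1.indicator hA, (hN.indicator_le hg.1 hA).trans_lt hg.2⟩

theorem add_mem (hN : IsAdmissibleQuasinorm N) {f g : Ω → ℝ} (hf : f ∈ functionSpace N)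
    (hg : g ∈ functionSpace N) : f + g ∈ functionSpace N := by
  obtain ⟨C, hC⟩ := hN.add_le
  have hS : MeasurableSet {x | |g x| ≤ |f x|} := measurableSet_le hg.1.abs hf.1.abs
  set S := {x | |g x| ≤ |f x|} with hSdef
  have hf' : Measurable fun x => |f x| := hf.1.abs
  have hg' : Measurable fun x => |g x| := hg.1.abs
  set F := S.indicator fun x => |f x| with hF
  set G := Sᶜ.indicator fun x => |g x| with hG
  have hFm : Measurable F := hf'.indicator hS
  have hGm : Measurable G := hg'.indicator hS.compl
  have hFX : F ∈ functionSpace N := hN.mem_of_abs_le hFm hf fun x => by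
    by_cases hx : x ∈ S <;> simp [hF, hx]
  have hGX : G ∈ functionSpace N := hN.mem_of_abs_le hGm hg fun x => by
    by_cases hx : x ∈ S <;> simp [hG, hx]
  have hFG : F + G ∈ functionSpace N := by
    refine ⟨hFm.add hGm, (hC F G hFm hGm ?_ ?_ ?_).trans_lt ?_⟩
    · exact fun x => Set.indicator_nonneg (fun _ _ => abs_nonneg _) x
    · exact fun x => Set.indicator_nonneg (fun _ _ => abs_nonneg _) x
    · exact disjoint_compl_right.mono Set.support_indicator_subset Set.support_indicator_subset
    · exact ENNReal.mul_lt_top ENNReal.coe_lt_top (ENNReal.add_lt_top.2 ⟨hFX.2, hGX.2⟩)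
  -- `F + G` is the maximum of `|f|` and `|g|`, with the supports of the summands disjoint.
  have h2 : (2 : ℝ) • (F + G) ∈ functionSpace N := ⟨hFG.1.const_smul _, hN.smul_lt_top 2 hFG⟩
  refine hN.mem_of_abs_le (hf.1.add hg.1) h2 fun x => ?_
  have h3 := abs_add_le (f x) (g x)
  rw [Pi.add_apply]
  refine h3.trans (le_trans ?_ (le_abs_self _))
  by_cases hx : x ∈ S
  · have : |g x| ≤ |f x| := hx
    simp [hF, hG, hx]
    linarith
  · have : |f x| < |g x| := not_le.1 hx
    simp [hF, hG, hx]
    linarith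

theorem sum_mem (hN : IsAdmissibleQuasinorm N) {ι : Type*} (s : Finset ι) {f : ι → Ω → ℝ}
    (hf : ∀ i ∈ s, f i ∈ functionSpace N) : ∑ i ∈ s, f i ∈ functionSpace N :=
  Finset.sum_induction f (· ∈ functionSpace N) (fun _ _ => hN.add_mem)
    ⟨measurable_zero, by rw [hN.map_zero]; exact ENNReal.zero_lt_top⟩ hf

theorem exists_sum_rpow_le (hN : IsAdmissibleQuasinorm N) (hp : 0 < p) (hpN : IsPNormable N p) :
    ∃ K : ℝ≥0, 0 < K ∧ ∀ {ι : Type} (s : Finset ι) (f : ι → Ω → ℝ),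
      (∀ i ∈ s, f i ∈ functionSpace N) → N (∑ i ∈ s, f i) ^ p ≤ K * ∑ i ∈ s, N (f i) ^ p := by
  classical
  obtain ⟨P, hPs, hPa, A, hA⟩ := hpN
  have h0 : (0 : Ω → ℝ) ∈ functionSpace N :=
    ⟨measurable_zero, by rw [hN.map_zero]; exact ENNReal.zero_lt_top⟩
  have hP0 : P 0 = 0 := by simpa using hPs 0 0 h0
  refine ⟨A ^ p * A ^ p + 1, by positivity, ?_⟩
  intro ι s f hf
  have hsum : P (∑ i ∈ s, f i) ^ p ≤ ∑ i ∈ s, P (f i) ^ p := by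
    induction s using Finset.induction_on with
    | empty => simp [hP0, hp]
    | insert a s ha ih =>
      rw [Finset.sum_insert ha, Finset.sum_insert ha]
      have hs : ∀ i ∈ s, f i ∈ functionSpace N := fun i hi => hf i (Finset.mem_insert_of_mem hi)
      exact (hPa _ (hf a (Finset.mem_insert_self _ _)) _ (hN.sum_mem s hs)).trans
        (add_le_add_right (ih hs) _)
  calc N (∑ i ∈ s, f i) ^ p ≤ (A * P (∑ i ∈ s, f i)) ^ p :=
        ENNReal.rpow_le_rpow (hA _ (hN.sum_mem s hf)).2 hp.le
    _ = (A : ℝ≥0∞) ^ p * P (∑ i ∈ s, f i) ^ p := ENNReal.mul_rpow_of_nonneg _ _ hp.le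
    _ ≤ (A : ℝ≥0∞) ^ p * ∑ i ∈ s, (A : ℝ≥0∞) ^ p * N (f i) ^ p := by
        gcongr
        refine hsum.trans (Finset.sum_le_sum fun i hi => ?_)
        rw [← ENNReal.mul_rpow_of_nonneg _ _ hp.le]
        exact ENNReal.rpow_le_rpow (hA _ (hf i hi)).1 hp.le
    _ = (A : ℝ≥0∞) ^ p * (A : ℝ≥0∞) ^ p * ∑ i ∈ s, N (f i) ^ p := by
        rw [← Finset.mul_sum, mul_assoc]
    _ ≤ _ := by
        push_cast
        rw [ENNReal.coe_rpow_of_nonneg _ hp.le]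
        exact mul_le_mul_left le_self_add _

end IsAdmissibleQuasinorm

/-- The set function `A ↦ ‖g 1_A‖ ^ p` attached to a quasinorm `N = ‖·‖` and a function `g`,
as a real number (so that it is meaningful for `g` of finite norm only). -/
noncomputable def normPowOn {Ω : Type*} (N : (Ω → ℝ) → ℝ≥0∞) (p : ℝ) (g : Ω → ℝ)
    (A : Set Ω) : ℝ :=
  (N (A.indicator g) ^ p).toReal

/-- The set functions `A ↦ ‖g 1_A‖ ^ p`, `g ∈ X`, are submeasures up to a constant and satisfy a
lower `q / p`-estimate, with constants independent of `g`. -/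
theorem exists_isLowerSubmeasure_normPowOn {Ω : Type*} [MeasurableSpace Ω]
    {N : (Ω → ℝ) → ℝ≥0∞} (hN : IsAdmissibleQuasinorm N) {p q : ℝ} (hp : 0 < p) (hq : 0 < q)
    (hpN : IsPNormable N p) (hqN : HasCrudeLowerEstimate N q) :
    ∃ K B : ℝ, 0 < K ∧ 0 ≤ B ∧
      ∀ g ∈ functionSpace N, IsLowerSubmeasure (normPowOn N p g) K B (q / p) := by
  classical
  obtain ⟨K, hK, hKsum⟩ := hN.exists_sum_rpow_le hp hpN
  obtain ⟨b, hb⟩ := hqN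
  refine ⟨K, (b : ℝ) ^ q, by exact_mod_cast hK, by positivity, fun g hg => ?_⟩
  have hfin : ∀ A, MeasurableSet A → N (A.indicator g) ^ p ≠ ∞ := fun A hA =>
    (ENNReal.rpow_lt_top_of_nonneg hp.le (hN.indicator_mem hg hA).2.ne).ne
  refine ⟨fun A => ENNReal.toReal_nonneg, ?_, ?_, ?_⟩
  · intro A A' hA hA' hAA'
    refine ENNReal.toReal_mono (hfin A' hA') (ENNReal.rpow_le_rpow ?_ hp.le)
    refine hN.mono _ _ (hg.1.indicator hA) (hg.1.indicator hA') fun x => ?_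
    by_cases hx : x ∈ A
    · simp [hx, hAA' hx]
    · simp [hx]
  · intro ι s A hA
    have hsum := hKsum s (fun i => (A i).indicator g) fun i hi => hN.indicator_mem hg (hA i hi)
    have hle : N ((⋃ i ∈ s, A i).indicator g) ≤ N (∑ i ∈ s, (A i).indicator g) := by
      refine hN.mono _ _ (hg.1.indicator (Finset.measurableSet_biUnion s hA))
        (hN.sum_mem s fun i hi => hN.indicator_mem hg (hA i hi)).1 fun x => ?_
      by_cases hx : x ∈ ⋃ i ∈ s, A i
      · have h1 : (∑ i ∈ s, (A i).indicator g) x = ((s.filter fun i => x ∈ A i).card : ℝ) * g x := by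
          rw [Finset.sum_apply, Finset.card_filter]
          push_cast
          rw [Finset.sum_mul]
          exact Finset.sum_congr rfl fun i _ => by by_cases h : x ∈ A i <;> simp [h]
        rw [h1, Set.indicator_of_mem hx, abs_mul]
        simp only [Set.mem_iUnion, exists_prop] at hx
        obtain ⟨i, hi, hxi⟩ := hx
        have h2 : (1 : ℝ) ≤ (s.filter fun i => x ∈ A i).card := by
          have : 0 < (s.filter fun i => x ∈ A i).card :=
            Finset.card_pos.2 ⟨i, Finset.mem_filter.2 ⟨hi, hxi⟩⟩
          exact_mod_cast this
        rw [abs_of_pos (by linarith : (0 : ℝ) < (s.filter fun i => x ∈ A i).card)]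
        exact le_mul_of_one_le_left (abs_nonneg _) h2
      · simp [Set.indicator_of_notMem hx]
    have h1 := (ENNReal.rpow_le_rpow hle hp.le).trans hsum
    have hs : ∑ i ∈ s, N ((A i).indicator g) ^ p ≠ ∞ :=
      ENNReal.sum_ne_top.2 fun i hi => hfin _ (hA i hi)
    have h2 := ENNReal.toReal_mono (ENNReal.mul_ne_top ENNReal.coe_ne_top hs) h1
    rw [ENNReal.toReal_mul, ENNReal.toReal_sum fun i hi => hfin _ (hA i hi)] at h2
    exact h2
  · intro ι s A hA hdisj
    have hX : ∀ i ∈ s, (A i).indicator g ∈ functionSpace N :=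
      fun i hi => hN.indicator_mem hg (hA i hi)
    have hpow : ∀ f : Ω → ℝ, ((N f ^ p).toReal) ^ (q / p) = (N f ^ q).toReal := by
      intro f
      rw [ENNReal.toReal_rpow, ← ENNReal.rpow_mul, mul_div_cancel₀ _ hp.ne']
    have h1 := hb s.card (fun j => (A (s.equivFin.symm j)).indicator g)
      (fun j => hX _ (s.equivFin.symm j).2) (by
        intro i j hij
        refine Disjoint.mono Set.support_indicator_subset Set.support_indicator_subset ?_
        refine hdisj (s.equivFin.symm i).2 (s.equivFin.symm j).2 fun h => hij ?_
        exact s.equivFin.symm.injective (Subtype.ext h))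
    have e1 : ∑ j, N ((A (s.equivFin.symm j)).indicator g) ^ q
        = ∑ i ∈ s, N ((A i).indicator g) ^ q := by
      rw [s.equivFin.symm.sum_comp fun i : s => N ((A i).indicator g) ^ q,
        Finset.sum_coe_sort s fun i => N ((A i).indicator g) ^ q]
    have e2 : ∑ j, (A (s.equivFin.symm j)).indicator g = ∑ i ∈ s, (A i).indicator g := by
      rw [s.equivFin.symm.sum_comp fun i : s => (A i).indicator g,
        Finset.sum_coe_sort s fun i => (A i).indicator g]
    have e3 : ∑ i ∈ s, (A i).indicator g = (⋃ i ∈ s, A i).indicator g := by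
      rw [Finset.indicator_biUnion s A hdisj]
      ext x; simp
    rw [e1, e2, e3] at h1
    have h2 : ∑ i ∈ s, N ((A i).indicator g) ^ q ≤ (b : ℝ≥0∞) ^ q * N g ^ q := by
      have h3 := h1.trans (mul_le_mul_right
        (hN.indicator_le hg.1 (Finset.measurableSet_biUnion s hA)) _)
      have h4 := ENNReal.rpow_le_rpow h3 hq.le
      rwa [← ENNReal.rpow_mul, one_div_mul_cancel hq.ne', ENNReal.rpow_one,
        ENNReal.mul_rpow_of_nonneg _ _ hq.le] at h4
    have hgq : N g ^ q ≠ ∞ := (ENNReal.rpow_lt_top_of_nonneg hq.le hg.2.ne).ne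
    have hbq : (b : ℝ≥0∞) ^ q ≠ ∞ :=
      (ENNReal.rpow_lt_top_of_nonneg hq.le ENNReal.coe_ne_top).ne
    have h5 := ENNReal.toReal_mono (ENNReal.mul_ne_top hbq hgq) h2
    rw [ENNReal.toReal_mul, ENNReal.toReal_sum fun i hi =>
      (ENNReal.rpow_lt_top_of_nonneg hq.le (hX i hi).2.ne).ne, ← ENNReal.toReal_rpow] at h5
    simp only [normPowOn, Set.indicator_univ, hpow]
    exact h5

/-! ### Convexity -/

section Convexity

variable {Ω : Type*} [MeasurableSpace Ω] {N : (Ω → ℝ) → ℝ≥0∞} {p q r : ℝ}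

theorem IsAdmissibleQuasinorm.rpow_sum_mem (hN : IsAdmissibleQuasinorm N) (hr : 0 < r) {n : ℕ}
    {f : Fin n → Ω → ℝ} (hf : ∀ i, f i ∈ functionSpace N) :
    (fun x => (∑ i, |f i x| ^ r) ^ (1 / r)) ∈ functionSpace N := by
  have habs : ∀ i, (fun x => |f i x|) ∈ functionSpace N := fun i =>
    hN.mem_of_abs_le (hf i).1.abs (hf i) fun x => by simp
  have hS : ((n : ℝ) ^ (1 / r)) • ∑ i, (fun x => |f i x|) ∈ functionSpace N := by
    have := hN.sum_mem Finset.univ fun i _ => habs i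
    exact ⟨this.1.const_smul _, hN.smul_lt_top _ this⟩
  have hm : Measurable (fun x => (∑ i, |f i x| ^ r) ^ (1 / r)) :=
    (Finset.measurable_fun_sum _ fun i _ => ((habs i).1.pow_const r)).pow_const _
  refine hN.mem_of_abs_le hm hS fun x => ?_
  rw [Pi.smul_apply, Finset.sum_apply, smul_eq_mul]
  set S := ∑ i, |f i x| with hSdef
  have hS0 : 0 ≤ S := Finset.sum_nonneg fun i _ => abs_nonneg _
  have h1 : ∑ i, |f i x| ^ r ≤ n * S ^ r := by
    calc ∑ i, |f i x| ^ r ≤ ∑ _i : Fin n, S ^ r := Finset.sum_le_sum fun i _ =>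
          Real.rpow_le_rpow (abs_nonneg _)
            (Finset.single_le_sum (f := fun i => |f i x|) (fun i _ => abs_nonneg _)
              (Finset.mem_univ i)) hr.le
      _ = n * S ^ r := by simp
  have h0 : 0 ≤ ∑ i, |f i x| ^ r :=
    Finset.sum_nonneg fun i _ => Real.rpow_nonneg (abs_nonneg _) _
  rw [abs_of_nonneg (Real.rpow_nonneg h0 _)]
  refine le_trans ?_ (le_abs_self _)
  calc (∑ i, |f i x| ^ r) ^ (1 / r) ≤ (n * S ^ r) ^ (1 / r) :=
        Real.rpow_le_rpow h0 h1 (by positivity)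
    _ = (n : ℝ) ^ (1 / r) * S := by
        rw [Real.mul_rpow (by positivity) (by positivity), ← Real.rpow_mul hS0,
          mul_one_div_cancel hr.ne', Real.rpow_one]

/-- A dyadic layer decomposition started at level `a`. -/
theorem le_add_sum_dyadic {h a : ℝ} (ha : 0 < a) {m : ℕ} (hm : h < 2 ^ m * a) :
    h ≤ a + ∑ k : Fin m, if 2 ^ (k : ℕ) * a ≤ h then 2 ^ ((k : ℕ) + 1) * a else 0 := by
  have hnn : ∀ k : Fin m, 0 ≤ if 2 ^ (k : ℕ) * a ≤ h then 2 ^ ((k : ℕ) + 1) * a else 0 := by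
    intro k
    split_ifs <;> positivity
  rcases lt_or_ge h a with hlt | hge
  · have := Finset.sum_nonneg fun k (_ : k ∈ Finset.univ) => hnn k
    linarith
  · obtain ⟨k, hk1, hk2⟩ := exists_nat_pow_near ((one_le_div ha).2 hge) (one_lt_two (α := ℝ))
    rw [le_div_iff₀ ha] at hk1
    rw [div_lt_iff₀ ha] at hk2
    have hkm : k < m := by
      have : (2 : ℝ) ^ k < 2 ^ m := lt_of_mul_lt_mul_right (hk1.trans_lt hm) ha.le
      exact (pow_lt_pow_iff_right₀ one_lt_two).1 this
    have := Finset.single_le_sum (fun k _ => hnn k) (Finset.mem_univ (⟨k, hkm⟩ : Fin m))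
    simp only [hk1, if_true] at this
    linarith

/-- A `p`-normable space with a crude lower estimate is `r`-convex for `r < p`. -/
theorem isRConvex_of_lt (hN : IsAdmissibleQuasinorm N) (hp : 0 < p) (hq : 0 < q)
    (hpN : IsPNormable N p) (hqN : HasCrudeLowerEstimate N q) (hr : 0 < r) (hrp : r < p) :
    IsRConvex N r := by
  classical
  obtain ⟨K, B, hK, hB, hφ⟩ := exists_isLowerSubmeasure_normPowOn hN hp hq hpN hqN
  obtain ⟨c, hc, hcov⟩ :=
    IsLowerSubmeasure.exists_le_sum_of_one_le (Ω := Ω) hK hB (div_pos hq hp)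
  set ρ : ℝ := 2 * (2 : ℝ) ^ (-(p / r)) with hρ
  have hρ0 : 0 ≤ ρ := by positivity
  have hρ1 : ρ < 1 := by
    have h1 : (2 : ℝ) ^ (-(p / r)) < 2 ^ (-1 : ℝ) :=
      Real.rpow_lt_rpow_of_exponent_lt one_lt_two (neg_lt_neg ((one_lt_div hr).2 hrp))
    rw [Real.rpow_neg_one] at h1
    rw [hρ]
    linarith
  have hρ' : 0 < 1 - ρ := by linarith
  set c' : ℝ := min (1 / 2) (c * (1 - ρ) / 4) with hc'
  have hc'0 : 0 < c' := lt_min (by norm_num) (by positivity)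
  -- A lower bound for `∑ a i`; the `a i` are assumed positive to start the dyadic levels at them.
  have main : ∀ (n : ℕ) (f : Fin n → Ω → ℝ), (∀ i, f i ∈ functionSpace N) →
      ∀ g : Ω → ℝ, (g = fun x => (∑ i, |f i x| ^ r) ^ (1 / r)) → 0 < N g →
      ∀ a : Fin n → ℝ, (∀ i, 0 < a i) →
      (∀ i, (N (f i)).toReal ^ r ≤ a i * (N g).toReal ^ r) → c' ≤ ∑ i, a i := by
    intro n f hf g hgdef hgpos a ha hfa
    by_contra! hlt
    have hgX : g ∈ functionSpace N := hgdef ▸ hN.rpow_sum_mem hr hf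
    have hg0 : ∀ x, 0 ≤ g x := by
      intro x
      rw [hgdef]
      exact Real.rpow_nonneg (Finset.sum_nonneg fun i _ => Real.rpow_nonneg (abs_nonneg _) _) _
    have hgr : ∀ x, g x ^ r = ∑ i, |f i x| ^ r := by
      intro x
      rw [hgdef]
      rw [← Real.rpow_mul (Finset.sum_nonneg fun i _ => Real.rpow_nonneg (abs_nonneg _) _),
        one_div_mul_cancel hr.ne', Real.rpow_one]
    set y := (N g).toReal with hy
    have hy0 : 0 < y := ENNReal.toReal_pos hgpos.ne' hgX.2.ne
    have hn : Nonempty (Fin n) := by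
      by_contra hn
      rw [not_nonempty_iff] at hn
      have : g = 0 := by
        rw [hgdef]
        ext x
        simp [hr.ne']
      rw [this, hN.map_zero] at hgpos
      exact lt_irrefl _ hgpos
    -- All levels above `2 ^ m * a i` are empty, because `|f i| ^ r ≤ g ^ r`.
    obtain ⟨m, hm⟩ : ∃ m : ℕ, ∀ i, 1 < 2 ^ m * a i := by
      have : ∀ i, ∃ m : ℕ, 1 < 2 ^ m * a i := by
        intro i
        obtain ⟨m, hm⟩ := pow_unbounded_of_one_lt (1 / a i) (one_lt_two (α := ℝ))
        exact ⟨m, (div_lt_iff₀ (ha i)).1 hm⟩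
      choose m hm using this
      refine ⟨∑ i, m i, fun i => (hm i).trans_le ?_⟩
      have := ha i
      gcongr
      · norm_num
      · exact Finset.single_le_sum (f := m) (fun _ _ => Nat.zero_le _) (Finset.mem_univ i)
    let A : Fin n × Fin m → Set Ω := fun j => {x | 2 ^ (j.2 : ℕ) * a j.1 * g x ^ r ≤ |f j.1 x| ^ r}
    let w : Fin n × Fin m → ℝ := fun j => 2 * (2 ^ ((j.2 : ℕ) + 1) * a j.1)
    have hA : ∀ j, MeasurableSet (A j) := fun j =>
      measurableSet_le ((hgX.1.pow_const r).const_mul _) ((hf j.1).1.abs.pow_const r)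
    have hw : ∀ j, 0 ≤ w j := fun j => by
      have := ha j.1
      positivity
    have hcover : ∀ x, 1 ≤ ∑ j, (A j).indicator (fun _ => w j) x := by
      intro x
      rcases (hg0 x).eq_or_lt with hgx | hgx
      -- Where `g` vanishes, all the sets are present, and a single term suffices.
      · have hxA : ∀ j, x ∈ A j := by
          intro j
          change _ * g x ^ r ≤ _
          rw [← hgx, Real.zero_rpow hr.ne', mul_zero]
          exact Real.rpow_nonneg (abs_nonneg _) _
        obtain ⟨i⟩ := hn
        have hsum : a i < 1 := by
          have h1 := Finset.single_le_sum (f := a) (fun i _ => (ha i).le) (Finset.mem_univ i)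
          have h2 : c' ≤ 1 / 2 := min_le_left _ _
          linarith
        have hm0 : m ≠ 0 := by
          rintro rfl
          have := hm i
          rw [pow_zero, one_mul] at this
          linarith
        have h1 := Finset.single_le_sum (f := fun j => (A j).indicator (fun _ => w j) x)
          (fun j _ => Set.indicator_nonneg (fun _ _ => hw j) x)
          (Finset.mem_univ ((i, ⟨m - 1, by omega⟩) : Fin n × Fin m))
        refine le_trans ?_ h1
        rw [Set.indicator_of_mem (hxA _)]
        simp only [w]
        rw [show m - 1 + 1 = m by omega]
        linarith [hm i]
      · have hG : 0 < g x ^ r := Real.rpow_pos_of_pos hgx r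
        have h1 : ∀ i, |f i x| ^ r / g x ^ r ≤ a i + ∑ k : Fin m,
            if 2 ^ (k : ℕ) * a i ≤ |f i x| ^ r / g x ^ r then 2 ^ ((k : ℕ) + 1) * a i else 0 := by
          intro i
          refine le_add_sum_dyadic (ha i) (lt_of_le_of_lt ?_ (hm i))
          rw [div_le_one hG, hgr]
          exact Finset.single_le_sum (f := fun i => |f i x| ^ r)
            (fun i _ => Real.rpow_nonneg (abs_nonneg _) _) (Finset.mem_univ i)
        have h2 := Finset.sum_le_sum fun i (_ : i ∈ (Finset.univ : Finset (Fin n))) => h1 i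
        rw [← Finset.sum_div, ← hgr, div_self hG.ne', Finset.sum_add_distrib] at h2
        have h3 : ∑ j, (A j).indicator (fun _ => w j) x = 2 * ∑ i, ∑ k : Fin m,
            if 2 ^ (k : ℕ) * a i ≤ |f i x| ^ r / g x ^ r then 2 ^ ((k : ℕ) + 1) * a i else 0 := by
          rw [Fintype.sum_prod_type, Finset.mul_sum]
          refine Finset.sum_congr rfl fun i _ => ?_
          rw [Finset.mul_sum]
          refine Finset.sum_congr rfl fun k _ => ?_
          rw [Set.indicator_apply, mul_ite, mul_zero]
          refine if_congr ?_ rfl rfl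
          rw [le_div_iff₀ hG]
          rfl
        have h4 : c' ≤ 1 / 2 := min_le_left _ _
        linarith
    have hbound := hcov _ (hφ g hgX) A w hA hw hcover
    have huniv : normPowOn N p g Set.univ = y ^ p := by
      rw [normPowOn, Set.indicator_univ, ENNReal.toReal_rpow]
    have hAbound : ∀ j, normPowOn N p g (A j) ≤ ((2 : ℝ) ^ (-(p / r))) ^ (j.2 : ℕ) * y ^ p := by
      rintro ⟨i, k⟩
      set b : ℝ := 2 ^ (k : ℕ) * a i with hb
      have hb0 : 0 < b := mul_pos (by positivity) (ha i)
      have h1 : N ((A (i, k)).indicator g) ≤ N ((b ^ (-(1 / r))) • f i) := by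
        refine hN.mono _ _ (hgX.1.indicator (hA _)) ((hf i).1.const_smul _) fun x => ?_
        by_cases hx : x ∈ A (i, k)
        · have hx' : b * g x ^ r ≤ |f i x| ^ r := hx
          rw [Set.indicator_of_mem hx, abs_of_nonneg (hg0 x), Pi.smul_apply, smul_eq_mul, abs_mul,
            abs_of_pos (Real.rpow_pos_of_pos hb0 _)]
          have h2 : g x ^ r ≤ b⁻¹ * |f i x| ^ r := by
            rw [inv_mul_eq_div, le_div_iff₀ hb0]; linarith
          have h3 := Real.rpow_le_rpow (Real.rpow_nonneg (hg0 x) _) h2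
            (one_div_nonneg.2 hr.le)
          rwa [← Real.rpow_mul (hg0 x), mul_one_div_cancel hr.ne', Real.rpow_one,
            Real.mul_rpow (by positivity) (by positivity), ← Real.rpow_mul (abs_nonneg _),
            mul_one_div_cancel hr.ne', Real.rpow_one, Real.inv_rpow hb0.le,
            ← Real.rpow_neg hb0.le] at h3
        · rw [Set.indicator_of_notMem hx, abs_zero]
          exact abs_nonneg _
      have h2 : (N ((A (i, k)).indicator g)).toReal ≤ b ^ (-(1 / r)) * (N (f i)).toReal := by
        have h3 := ENNReal.toReal_mono (hN.smul_lt_top _ (hf i)).ne h1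
        rwa [hN.smul _ _ (hf i).1, ENNReal.toReal_mul, ENNReal.toReal_ofReal (abs_nonneg _),
          abs_of_pos (Real.rpow_pos_of_pos hb0 _)] at h3
      have h3 : (N (f i)).toReal ≤ a i ^ (1 / r) * y := by
        have h4 := Real.rpow_le_rpow (by positivity) (hfa i) (one_div_nonneg.2 hr.le)
        rwa [← Real.rpow_mul ENNReal.toReal_nonneg, mul_one_div_cancel hr.ne', Real.rpow_one,
          Real.mul_rpow (ha i).le (by positivity), ← Real.rpow_mul hy0.le,
          mul_one_div_cancel hr.ne', Real.rpow_one] at h4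
      have h4 : (N ((A (i, k)).indicator g)).toReal ≤ ((2 : ℝ) ^ (k : ℕ)) ^ (-(1 / r)) * y := by
        calc _ ≤ b ^ (-(1 / r)) * (N (f i)).toReal := h2
          _ ≤ b ^ (-(1 / r)) * (a i ^ (1 / r) * y) := by gcongr
          _ = _ := by
              have : 0 < a i ^ (1 / r) := Real.rpow_pos_of_pos (ha i) _
              rw [hb, Real.mul_rpow (by positivity) (ha i).le, Real.rpow_neg (ha i).le]
              field_simp
      rw [normPowOn, ← ENNReal.toReal_rpow]
      calc _ ≤ (((2 : ℝ) ^ (k : ℕ)) ^ (-(1 / r)) * y) ^ p :=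
            Real.rpow_le_rpow ENNReal.toReal_nonneg h4 hp.le
        _ = _ := by
            rw [Real.mul_rpow (by positivity) hy0.le, ← Real.rpow_mul (by positivity),
              ← Real.rpow_natCast, ← Real.rpow_mul (by norm_num), ← Real.rpow_natCast,
              ← Real.rpow_mul (by norm_num)]
            congr 2
            ring
    have hyp : 0 < y ^ p := Real.rpow_pos_of_pos hy0 p
    have hgeom : ∑ k : Fin m, ρ ^ (k : ℕ) ≤ 1 / (1 - ρ) := by
      rw [Fin.sum_univ_eq_sum_range fun k => ρ ^ k, le_div_iff₀ hρ', geom_sum_mul_neg]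
      have : 0 ≤ ρ ^ m := pow_nonneg hρ0 m
      linarith
    have hfinal : c * y ^ p ≤ 4 / (1 - ρ) * (∑ i, a i) * y ^ p := by
      rw [huniv] at hbound
      refine hbound.trans ?_
      calc ∑ j, w j * normPowOn N p g (A j)
          ≤ ∑ j : Fin n × Fin m, w j * (((2 : ℝ) ^ (-(p / r))) ^ (j.2 : ℕ) * y ^ p) :=
            Finset.sum_le_sum fun j _ => mul_le_mul_of_nonneg_left (hAbound j) (hw j)
        _ = ∑ i, 4 * a i * y ^ p * ∑ k : Fin m, ρ ^ (k : ℕ) := by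
            rw [Fintype.sum_prod_type]
            refine Finset.sum_congr rfl fun i _ => ?_
            rw [Finset.mul_sum]
            refine Finset.sum_congr rfl fun k _ => ?_
            simp only [w, hρ, mul_pow, pow_succ]
            ring
        _ ≤ ∑ i, 4 * a i * y ^ p * (1 / (1 - ρ)) := by
            refine Finset.sum_le_sum fun i _ => mul_le_mul_of_nonneg_left hgeom ?_
            have := ha i
            positivity
        _ = _ := by
            rw [← Finset.sum_mul, ← Finset.sum_mul, ← Finset.mul_sum]
            ring
    have h1 := le_of_mul_le_mul_right hfinal hyp
    rw [div_mul_eq_mul_div, le_div_iff₀ hρ'] at h1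
    have h2 : c' ≤ c * (1 - ρ) / 4 := min_le_right _ _
    linarith
  rw [IsRConvex, convexityConstant]
  refine lt_of_le_of_lt (sInf_le (a := ENNReal.ofReal ((1 / c') ^ (1 / r))) ?_)
    ENNReal.ofReal_lt_top
  intro n f hf
  set g : Ω → ℝ := fun x => (∑ i, |f i x| ^ r) ^ (1 / r) with hgdef
  rcases eq_or_ne (N g) 0 with hg0 | hg0
  · rw [hg0]; exact zero_le
  have hgX : g ∈ functionSpace N := hN.rpow_sum_mem hr hf
  set y := (N g).toReal with hy
  have hy0 : 0 < y := ENNReal.toReal_pos hg0 hgX.2.ne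
  have hyr : 0 < y ^ r := Real.rpow_pos_of_pos hy0 r
  have key : c' * y ^ r ≤ ∑ i, (N (f i)).toReal ^ r := by
    refine le_of_forall_pos_le_add fun ε hε => ?_
    set η := ε / ((n + 1) * y ^ r) with hη
    have hη0 : 0 < η := by positivity
    have h1 := main n f hf g hgdef (pos_iff_ne_zero.2 hg0)
      (fun i => (N (f i)).toReal ^ r / y ^ r + η) (fun i => by positivity) (fun i => by
        rw [add_mul, div_mul_cancel₀ _ hyr.ne']
        have : 0 ≤ η * y ^ r := by positivity
        linarith)
    rw [Finset.sum_add_distrib, ← Finset.sum_div, Finset.sum_const, Finset.card_univ,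
      Fintype.card_fin, nsmul_eq_mul] at h1
    have h2 : n * η * y ^ r ≤ ε := by
      rw [hη]
      field_simp
      linarith
    calc c' * y ^ r ≤ ((∑ i, (N (f i)).toReal ^ r) / y ^ r + n * η) * y ^ r := by gcongr
      _ = ∑ i, (N (f i)).toReal ^ r + n * η * y ^ r := by
          rw [add_mul, div_mul_cancel₀ _ hyr.ne']
      _ ≤ _ := by linarith
  have hs0 : 0 ≤ ∑ i, (N (f i)).toReal ^ r :=
    Finset.sum_nonneg fun i _ => Real.rpow_nonneg ENNReal.toReal_nonneg _
  have hfinal : y ≤ (1 / c') ^ (1 / r) * (∑ i, (N (f i)).toReal ^ r) ^ (1 / r) := by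
    rw [← Real.mul_rpow (by positivity) hs0]
    have h1 : y ^ r ≤ 1 / c' * ∑ i, (N (f i)).toReal ^ r := by
      rw [one_div_mul_eq_div, le_div_iff₀ hc'0]; linarith
    have h2 := Real.rpow_le_rpow hyr.le h1 (one_div_nonneg.2 hr.le)
    rwa [← Real.rpow_mul hy0.le, mul_one_div_cancel hr.ne', Real.rpow_one] at h2
  have hsum : ∑ i, N (f i) ^ r = ENNReal.ofReal (∑ i, (N (f i)).toReal ^ r) := by
    rw [ENNReal.ofReal_sum_of_nonneg fun i _ => Real.rpow_nonneg ENNReal.toReal_nonneg _]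
    refine Finset.sum_congr rfl fun i _ => ?_
    rw [← ENNReal.ofReal_rpow_of_nonneg ENNReal.toReal_nonneg hr.le,
      ENNReal.ofReal_toReal (hf i).2.ne]
  rw [hsum, ENNReal.ofReal_rpow_of_nonneg hs0 (one_div_nonneg.2 hr.le),
    ← ENNReal.ofReal_mul (by positivity), ← ENNReal.ofReal_toReal hgX.2.ne]
  exact ENNReal.ofReal_le_ofReal hfinal

end Convexity

/-! ### Measures below a set function, and null sets -/

namespace IsLowerSubmeasure

variable {Ω : Type*} [MeasurableSpace Ω] {φ : Set Ω → ℝ} {K B t : ℝ}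

/-- The costs `∑ i, w i * φ (A i)` of the weighted covers `f ≤ ∑ i, w i • 1_{A i}` of `f`. -/
def coverCosts (φ : Set Ω → ℝ) (f : Ω → ℝ) : Set ℝ :=
  {y | ∃ (ι : Type) (_ : Fintype ι) (A : ι → Set Ω) (w : ι → ℝ), (∀ i, MeasurableSet (A i)) ∧
    (∀ i, 0 ≤ w i) ∧ (∀ x, f x ≤ ∑ i, (A i).indicator (fun _ => w i) x) ∧
    y = ∑ i, w i * φ (A i)}

theorem coverCosts_nonneg (h : IsLowerSubmeasure φ K B t) {f : Ω → ℝ} {y : ℝ}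
    (hy : y ∈ coverCosts φ f) : 0 ≤ y := by
  obtain ⟨ι, _, A, w, _, hw, _, rfl⟩ := hy
  exact Finset.sum_nonneg fun i _ => mul_nonneg (hw i) (h.nonneg _)

theorem coverCosts_bddBelow (h : IsLowerSubmeasure φ K B t) (f : Ω → ℝ) :
    BddBelow (coverCosts φ f) :=
  ⟨0, fun _ hy => h.coverCosts_nonneg hy⟩

theorem mem_coverCosts_of_le_indicator {f : Ω → ℝ} {a : ℝ} {A : Set Ω} (ha : 0 ≤ a)
    (hA : MeasurableSet A) (hf : ∀ x, f x ≤ A.indicator (fun _ => a) x) :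
    a * φ A ∈ coverCosts φ f :=
  ⟨Unit, inferInstance, fun _ => A, fun _ => a, fun _ => hA, fun _ => ha, by simpa using hf,
    by simp⟩

theorem coverCosts_nonempty (f : SimpleFunc Ω ℝ) : (coverCosts φ f).Nonempty := by
  obtain ⟨C, hC⟩ := f.finite_range.bddAbove
  refine ⟨_, mem_coverCosts_of_le_indicator (a := max C 0) (le_max_right _ _)
    MeasurableSet.univ fun x => ?_⟩
  rw [Set.indicator_univ]
  exact (hC ⟨x, rfl⟩).trans (le_max_left _ _)

theorem add_mem_coverCosts {f g : Ω → ℝ} {y z : ℝ} (hy : y ∈ coverCosts φ f)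
    (hz : z ∈ coverCosts φ g) : y + z ∈ coverCosts φ (f + g) := by
  obtain ⟨ι, _, A, w, hA, hw, hf, rfl⟩ := hy
  obtain ⟨ι', _, A', w', hA', hw', hg, rfl⟩ := hz
  refine ⟨ι ⊕ ι', inferInstance, Sum.elim A A', Sum.elim w w', ?_, ?_, fun x => ?_, ?_⟩
  · rintro (i | i)
    exacts [hA i, hA' i]
  · rintro (i | i)
    exacts [hw i, hw' i]
  · rw [Fintype.sum_sum_type]
    exact add_le_add (hf x) (hg x)
  · rw [Fintype.sum_sum_type]
    rfl

theorem smul_mem_coverCosts {f : Ω → ℝ} {y a : ℝ} (ha : 0 ≤ a) (hy : y ∈ coverCosts φ f) :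
    a * y ∈ coverCosts φ (a • f) := by
  obtain ⟨ι, _, A, w, hA, hw, hf, rfl⟩ := hy
  refine ⟨ι, inferInstance, A, fun i => a * w i, hA, fun i => mul_nonneg ha (hw i),
    fun x => ?_, ?_⟩
  · have := mul_le_mul_of_nonneg_left (hf x) ha
    rw [Finset.mul_sum] at this
    refine this.trans_eq (Finset.sum_congr rfl fun i _ => ?_)
    by_cases hx : x ∈ A i <;> simp [hx]
  · rw [Finset.mul_sum]
    exact Finset.sum_congr rfl fun i _ => by ring

/-- A linear functional of value `c` at `1` below the cost of covers, by the Hahn–Banach theorem: the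
infimum of `coverCosts φ f` is a sublinear functional of `f`. -/
theorem exists_linearMap_le (h : IsLowerSubmeasure φ K B t) {c : ℝ} (hc : 0 ≤ c)
    (hcov : ∀ y ∈ coverCosts φ 1, c ≤ y) :
    ∃ L : SimpleFunc Ω ℝ →ₗ[ℝ] ℝ, L 1 = c ∧
      ∀ f : SimpleFunc Ω ℝ, ∀ y ∈ coverCosts φ f, L f ≤ y := by
  let P : SimpleFunc Ω ℝ → ℝ := fun f => sInf (coverCosts φ f)
  have hP0 : ∀ f, 0 ≤ P f := fun f => Real.sInf_nonneg fun y hy => h.coverCosts_nonneg hy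
  have hle : ∀ (f : SimpleFunc Ω ℝ) (y : ℝ), y ∈ coverCosts φ f → P f ≤ y :=
    fun f y hy => csInf_le (h.coverCosts_bddBelow f) hy
  have hhom' : ∀ a : ℝ, 0 < a → ∀ f, P (a • f) ≤ a * P f := by
    intro a ha f
    rw [mul_comm, ← div_le_iff₀ ha]
    refine le_csInf (coverCosts_nonempty f) fun y hy => ?_
    rw [div_le_iff₀ ha, mul_comm]
    exact hle _ _ (smul_mem_coverCosts ha.le hy)
  have hhom : ∀ a : ℝ, 0 < a → ∀ f, P (a • f) = a * P f := by
    intro a ha f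
    refine le_antisymm (hhom' a ha f) ?_
    have := hhom' a⁻¹ (inv_pos.2 ha) (a • f)
    rwa [inv_smul_smul₀ ha.ne', inv_mul_eq_div, le_div_iff₀ ha, mul_comm] at this
  have hadd : ∀ f g, P (f + g) ≤ P f + P g := by
    intro f g
    have h1 : ∀ y ∈ coverCosts φ f, ∀ z ∈ coverCosts φ g, P (f + g) ≤ y + z :=
      fun y hy z hz => hle _ _ (add_mem_coverCosts hy hz)
    have h2 : ∀ y ∈ coverCosts φ f, P (f + g) - P g ≤ y := by
      intro y hy
      have : P (f + g) - y ≤ P g :=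
        le_csInf (coverCosts_nonempty g) fun z hz => by linarith [h1 y hy z hz]
      linarith
    have h3 : P (f + g) - P g ≤ P f := le_csInf (coverCosts_nonempty f) h2
    linarith
  have hcP : c ≤ P 1 := le_csInf (coverCosts_nonempty 1) hcov
  have hsmul : ∀ a : ℝ, a * c ≤ P (a • (1 : SimpleFunc Ω ℝ)) := by
    intro a
    rcases lt_or_ge 0 a with ha | ha
    · rw [hhom a ha]
      exact mul_le_mul_of_nonneg_left hcP ha.le
    · exact (mul_nonpos_of_nonpos_of_nonneg ha hc).trans (hP0 _)
  -- On an empty space `1 = 0`, and then `c = 0`.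
  have hwell : ∀ a : ℝ, a • (1 : SimpleFunc Ω ℝ) = 0 → (RingHom.id ℝ) a • c = 0 := by
    intro a ha
    have h0 : P 0 = 0 := by
      refine le_antisymm ?_ (hP0 0)
      have : (0 : ℝ) * φ ∅ ∈ coverCosts φ ((0 : SimpleFunc Ω ℝ) : Ω → ℝ) :=
        mem_coverCosts_of_le_indicator le_rfl MeasurableSet.empty (by simp)
      simpa using hle 0 _ this
    have h1 := hsmul a
    have h2 := hsmul (-a)
    rw [neg_smul, ha, neg_zero, h0] at h2
    rw [ha, h0] at h1
    simp only [RingHom.id_apply, smul_eq_mul]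
    linarith
  obtain ⟨L, hL1, hL2⟩ := exists_extension_of_le_sublinear
    (LinearPMap.mkSpanSingleton' (1 : SimpleFunc Ω ℝ) c hwell) P hhom hadd (by
      rintro ⟨f, hf⟩
      obtain ⟨a, rfl⟩ := Submodule.mem_span_singleton.1 hf
      rw [LinearPMap.mkSpanSingleton'_apply]
      exact hsmul a)
  refine ⟨L, ?_, fun f y hy => (hL2 f).trans (hle f y hy)⟩
  exact (hL1 ⟨1, Submodule.mem_span_singleton_self 1⟩).trans
    (LinearPMap.mkSpanSingleton'_apply_self _ _ hwell _)

theorem exists_measure_le_of_continuous (h : IsLowerSubmeasure φ K B t) {c : ℝ} (hc : 0 ≤ c)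
    (hcov : ∀ y ∈ coverCosts φ 1, c ≤ y)
    (hcont : ∀ A : ℕ → Set Ω, (∀ n, MeasurableSet (A n)) → Antitone A → ⋂ n, A n = ∅ →
      Filter.Tendsto (fun n => φ (A n)) Filter.atTop (𝓝 0)) :
    ∃ μ : Measure Ω, (∀ A, MeasurableSet A → μ A ≤ ENNReal.ofReal (φ A)) ∧
      μ Set.univ = ENNReal.ofReal c := by
  obtain ⟨L, hL1, hL⟩ := h.exists_linearMap_le hc hcov
  let I : Set Ω → SimpleFunc Ω ℝ := fun A => SimpleFunc.restrict 1 A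
  have hI : ∀ A, MeasurableSet A → ∀ x, I A x = A.indicator (fun _ => (1 : ℝ)) x := by
    intro A hA x
    rw [SimpleFunc.restrict_apply _ hA]
    rfl
  have hle : ∀ A, MeasurableSet A → L (I A) ≤ φ A := by
    intro A hA
    have := mem_coverCosts_of_le_indicator (φ := φ) (f := I A) zero_le_one hA
      fun x => (hI A hA x).le
    simpa using hL _ _ this
  have hpos : ∀ A, MeasurableSet A → 0 ≤ L (I A) := by
    intro A hA
    have : (0 : ℝ) * φ ∅ ∈ coverCosts φ (-(I A) : SimpleFunc Ω ℝ) := by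
      refine mem_coverCosts_of_le_indicator le_rfl MeasurableSet.empty fun x => ?_
      rw [SimpleFunc.coe_neg, Pi.neg_apply, hI A hA, Set.indicator_empty]
      exact neg_nonpos.2 (Set.indicator_nonneg (fun _ _ => zero_le_one) x)
    have := hL _ _ this
    rw [map_neg, zero_mul] at this
    linarith
  have hadd : ∀ A A', MeasurableSet A → MeasurableSet A' → Disjoint A A' →
      L (I (A ∪ A')) = L (I A) + L (I A') := by
    intro A A' hA hA' hd
    rw [← map_add]
    congr 1
    ext x
    rw [SimpleFunc.coe_add, Pi.add_apply, hI _ hA, hI _ hA', hI _ (hA.union hA'),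
      Set.indicator_union_of_disjoint hd]
  have hring : IsSetRing {A : Set Ω | MeasurableSet A} :=
    ⟨MeasurableSet.empty, fun _ _ h1 h2 => h1.union h2, fun _ _ h1 h2 => h1.diff h2⟩
  let m : AddContent ℝ≥0∞ {A : Set Ω | MeasurableSet A} :=
    hring.addContent_of_union (fun A => ENNReal.ofReal (L (I A)))
      (by
        rw [ENNReal.ofReal_eq_zero]
        exact (hle ∅ MeasurableSet.empty).trans h.empty.le)
      (by
        intro A A' hA hA' hd
        rw [hadd A A' hA hA' hd, ENNReal.ofReal_add (hpos A hA) (hpos A' hA')])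
  have hm : ∀ A, m A = ENNReal.ofReal (L (I A)) := fun _ => rfl
  have hσ := fun (f : ℕ → Set Ω) (hf : ∀ i, MeasurableSet (f i))
      (hd : Pairwise (Function.onFun Disjoint f)) =>
    addContent_iUnion_eq_sum_of_tendsto_zero hring m (fun _ _ => ENNReal.ofReal_ne_top)
      (fun s hs hanti hempty => by
        have h1 := ENNReal.tendsto_ofReal (hcont s hs hanti hempty)
        rw [ENNReal.ofReal_zero] at h1
        exact tendsto_of_tendsto_of_tendsto_of_le_of_le tendsto_const_nhds h1
          (fun _ => zero_le) fun n => ENNReal.ofReal_le_ofReal (hle _ (hs n)))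
      hf (MeasurableSet.iUnion hf) hd
  refine ⟨Measure.ofMeasurable (fun A _ => m A) m.empty' fun f hf hd => hσ f hf hd, ?_, ?_⟩
  · intro A hA
    rw [Measure.ofMeasurable_apply A hA]
    exact ENNReal.ofReal_le_ofReal (hle A hA)
  · rw [Measure.ofMeasurable_apply _ MeasurableSet.univ, hm, ← hL1]
    congr 2
    ext x
    rw [hI _ MeasurableSet.univ]
    simp

/-- Exhaustivity. -/
theorem exists_lt_of_pairwise_disjoint (h : IsLowerSubmeasure φ K B t) (ht : 0 < t)
    {D : ℕ → Set Ω} (hD : ∀ n, MeasurableSet (D n)) (hdisj : Pairwise (Function.onFun Disjoint D))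
    {ε : ℝ} (hε : 0 < ε) : ∃ n, φ (D n) < ε := by
  by_contra! hcon
  have hεt : 0 < ε ^ t := Real.rpow_pos_of_pos hε t
  obtain ⟨J, hJ⟩ := exists_nat_gt (B * φ Set.univ ^ t / ε ^ t)
  have h1 := h.sum_rpow_le (Finset.range J) D (fun i _ => hD i) fun i _ j _ hij => hdisj hij
  have h2 : ∑ _i ∈ Finset.range J, ε ^ t ≤ ∑ i ∈ Finset.range J, φ (D i) ^ t :=
    Finset.sum_le_sum fun i _ => Real.rpow_le_rpow hε.le (hcon i) ht.le
  rw [Finset.sum_const, Finset.card_range, nsmul_eq_mul] at h2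
  rw [div_lt_iff₀ hεt] at hJ
  linarith

/-- Continuity at `∅` follows from continuity along increasing sequences and exhaustivity: if
`φ (A n) ≥ ε` for all `n`, infinitely many disjoint differences `A n \ A m` have `φ > ε / 2`. -/
theorem tendsto_zero_of_antitone (h : IsLowerSubmeasure φ K B t) (ht : 0 < t)
    (hbelow : ∀ A : ℕ → Set Ω, (∀ n, MeasurableSet (A n)) → Monotone A →
      Filter.Tendsto (fun n => φ (A n)) Filter.atTop (𝓝 (φ (⋃ n, A n))))
    {A : ℕ → Set Ω} (hA : ∀ n, MeasurableSet (A n)) (hanti : Antitone A)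
    (hempty : ⋂ n, A n = ∅) : Filter.Tendsto (fun n => φ (A n)) Filter.atTop (𝓝 0) := by
  have hmono : ∀ m n, m ≤ n → φ (A n) ≤ φ (A m) :=
    fun m n hmn => h.mono _ _ (hA n) (hA m) (hanti hmn)
  suffices hsmall : ∀ ε > 0, ∃ n, φ (A n) < ε by
    rw [Metric.tendsto_atTop]
    intro ε hε
    obtain ⟨n, hn⟩ := hsmall ε hε
    refine ⟨n, fun m hm => ?_⟩
    rw [Real.dist_eq, sub_zero, abs_of_nonneg (h.nonneg _)]
    exact (hmono n m hm).trans_lt hn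
  intro ε hε
  by_contra! hcon
  have hnext : ∀ n, ∃ m, n < m ∧ ε / 2 < φ (A n \ A m) := by
    intro n
    have h1 := hbelow (fun m => A n \ A m) (fun m => (hA n).diff (hA m))
      fun i j hij => Set.sdiff_subset_sdiff_right (hanti hij)
    rw [← Set.sdiff_iInter, hempty, Set.sdiff_empty] at h1
    have h2 : ε / 2 < φ (A n) := by linarith [hcon n]
    obtain ⟨m, hm1, hm2⟩ := ((h1.eventually_const_lt h2).and (Filter.eventually_gt_atTop n)).exists
    exact ⟨m, hm2, hm1⟩
  choose next hlt hnext using hnext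
  let s : ℕ → ℕ := fun j => next^[j] 0
  have hs : ∀ j, s (j + 1) = next (s j) := fun j => Function.iterate_succ_apply' next j 0
  have hsmono : Monotone s := monotone_nat_of_le_succ fun j => by rw [hs]; exact (hlt _).le
  have hdisj : Pairwise (Function.onFun Disjoint fun j => A (s j) \ A (s (j + 1))) := by
    refine (pairwise_disjoint_on _).2 fun i j hij => ?_
    refine Set.disjoint_left.2 fun x hx hx' => hx.2 ?_
    exact hanti (hsmono (Nat.succ_le_of_lt hij)) hx'.1
  obtain ⟨j, hj⟩ := h.exists_lt_of_pairwise_disjoint ht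
    (fun j => (hA (s j)).diff (hA (s (j + 1)))) hdisj (half_pos hε)
  have := hnext (s j)
  rw [← hs] at this
  linarith

theorem exists_null_set_le_two_mul (h : IsLowerSubmeasure φ K B t) (ν : Measure Ω) :
    ∃ S, MeasurableSet S ∧ ν S = 0 ∧ ∀ A, MeasurableSet A → ν A = 0 → φ A ≤ 2 * φ S := by
  by_contra! hcon
  set V : Set ℝ := {y | ∃ A, MeasurableSet A ∧ ν A = 0 ∧ y = φ A} with hV
  have hbdd : BddAbove V := by
    refine ⟨φ Set.univ, ?_⟩
    rintro _ ⟨A, hA, _, rfl⟩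
    exact h.le_univ hA
  have hempty : φ ∅ ∈ V := ⟨∅, MeasurableSet.empty, measure_empty, rfl⟩
  have hpos : 0 < sSup V := by
    obtain ⟨A, hA, hνA, hlt⟩ := hcon ∅ MeasurableSet.empty measure_empty
    rw [h.empty, mul_zero] at hlt
    exact hlt.trans_le (le_csSup hbdd ⟨A, hA, hνA, rfl⟩)
  obtain ⟨_, ⟨S, hS, hνS, rfl⟩, hlt⟩ := exists_lt_of_lt_csSup ⟨_, hempty⟩ (half_lt_self hpos)
  obtain ⟨A, hA, hνA, hlt'⟩ := hcon S hS hνS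
  have := le_csSup hbdd ⟨A, hA, hνA, rfl⟩
  linarith

/-- A Halmos–Savage exhaustion: if every set `S` carries a measure below `φ` of mass at least
`c * φ S`, then `φ` has the null sets of a finite measure. One chooses inductively a set `A n`, null
for the preceding measures and nearly as large as possible for `φ`, and then a measure for `A n`. The
sets `A n \ ⋃ m > n, A m` are disjoint, and the measure of `A n` lives there, so `φ (A n)` becomes
arbitrarily small. -/
theorem exists_finite_measure_null_iff (h : IsLowerSubmeasure φ K B t) (ht : 0 < t) {c : ℝ}
    (hc : 0 < c) (hex : ∀ S, MeasurableSet S → ∃ μ : Measure Ω,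
      (∀ A, MeasurableSet A → μ A ≤ ENNReal.ofReal (φ A)) ∧ ENNReal.ofReal (c * φ S) ≤ μ S) :
    ∃ μ : Measure Ω, IsFiniteMeasure μ ∧ ∀ A, MeasurableSet A → (μ A = 0 ↔ φ A = 0) := by
  choose! M hMle hMge using hex
  choose sel hselm hsel0 hselmax using h.exists_null_set_le_two_mul
  let ν : ℕ → Measure Ω := fun n => Nat.rec 0 (fun _ ν => ν + M (sel ν)) n
  let A : ℕ → Set Ω := fun n => sel (ν n)
  let κ : ℕ → Measure Ω := fun n => M (A n)
  have hνsucc : ∀ n, ν (n + 1) = ν n + κ n := fun n => rfl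
  have hνzero : ∀ n E, (ν n E = 0 ↔ ∀ i < n, κ i E = 0) := by
    intro n E
    induction n with
    | zero => simp [ν]
    | succ n ih =>
      rw [hνsucc, Measure.add_apply, add_eq_zero, ih, Nat.forall_lt_succ_right]
  have hA : ∀ n, MeasurableSet (A n) := fun n => hselm _
  have hκA : ∀ i n, i < n → κ i (A n) = 0 := fun i n hin =>
    (hνzero n (A n)).1 (hsel0 (ν n)) i hin
  refine ⟨Measure.sum fun n => ((2 : ℝ≥0∞)⁻¹ ^ n) • κ n, ⟨?_⟩, fun E hE => ?_⟩
  · rw [Measure.sum_apply _ MeasurableSet.univ]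
    calc ∑' n, (((2 : ℝ≥0∞)⁻¹ ^ n) • κ n) Set.univ
        ≤ ∑' n, (2 : ℝ≥0∞)⁻¹ ^ n * ENNReal.ofReal (φ Set.univ) :=
          ENNReal.tsum_le_tsum fun n => by
            rw [Measure.smul_apply, smul_eq_mul]
            gcongr
            exact hMle _ (hA n) _ MeasurableSet.univ
      _ = (1 - 2⁻¹)⁻¹ * ENNReal.ofReal (φ Set.univ) := by
          rw [ENNReal.tsum_mul_right, ENNReal.tsum_geometric]
      _ < ∞ := by
          refine ENNReal.mul_lt_top ?_ ENNReal.ofReal_lt_top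
          rw [ENNReal.one_sub_inv_two, inv_inv]
          exact ENNReal.ofNat_lt_top
  · have hzero : (Measure.sum fun n => ((2 : ℝ≥0∞)⁻¹ ^ n) • κ n) E = 0 ↔ ∀ n, κ n E = 0 := by
      rw [Measure.sum_apply _ hE, ENNReal.tsum_eq_zero]
      refine forall_congr' fun n => ?_
      rw [Measure.smul_apply, smul_eq_mul, mul_eq_zero]
      have : (2 : ℝ≥0∞)⁻¹ ^ n ≠ 0 := pow_ne_zero _ (by simp)
      simp [this]
    rw [hzero]
    constructor
    · intro hκE
      have hφE : ∀ n, φ E ≤ 2 * φ (A n) := fun n =>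
        hselmax (ν n) E hE ((hνzero n E).2 fun i _ => hκE i)
      let T : ℕ → Set Ω := fun n => ⋃ i, A (n + 1 + i)
      have hT : ∀ n, MeasurableSet (T n) := fun n => MeasurableSet.iUnion fun i => hA _
      have hdisj : Pairwise (Function.onFun Disjoint fun n => A n \ T n) := by
        refine (pairwise_disjoint_on _).2 fun i j hij => ?_
        refine Set.disjoint_left.2 fun x hx hx' => hx.2 ?_
        refine Set.mem_iUnion.2 ⟨j - (i + 1), ?_⟩
        rw [Nat.add_sub_cancel' (Nat.succ_le_of_lt hij)]
        exact hx'.1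
      have hlow : ∀ n, c * φ (A n) ≤ φ (A n \ T n) := by
        intro n
        have h1 : κ n (T n) = 0 :=
          measure_iUnion_null fun i => hκA n _ (by omega)
        have h2 := (hMge _ (hA n)).trans_eq (measure_sdiff_null h1).symm
        have h3 := h2.trans (hMle _ (hA n) _ ((hA n).diff (hT n)))
        exact (ENNReal.ofReal_le_ofReal_iff (h.nonneg _)).1 h3
      refine le_antisymm (le_of_forall_pos_le_add fun ε hε => ?_) (h.nonneg E)
      obtain ⟨n, hn⟩ := h.exists_lt_of_pairwise_disjoint ht
        (fun n => (hA n).diff (hT n)) hdisj (show 0 < c * (ε / 2) by positivity)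
      have h4 : φ (A n) < ε / 2 := lt_of_mul_lt_mul_left ((hlow n).trans_lt hn) hc.le
      linarith [hφE n]
    · intro hφE n
      have := hMle _ (hA n) E hE
      rw [hφE, ENNReal.ofReal_zero] at this
      exact le_antisymm this zero_le

end IsLowerSubmeasure

/-! ### The control measure of a quasinorm -/

section ControlMeasure

variable {Ω : Type*} [MeasurableSpace Ω] {N : (Ω → ℝ) → ℝ≥0∞} {p q : ℝ}

theorem tendsto_normPowOn_of_monotone (hN : IsAdmissibleQuasinorm N) (hp : 0 < p) {g : Ω → ℝ}
    (hg : g ∈ functionSpace N) (hg0 : ∀ x, 0 ≤ g x) (A : ℕ → Set Ω)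
    (hA : ∀ n, MeasurableSet (A n)) (hmono : Monotone A) :
    Filter.Tendsto (fun n => normPowOn N p g (A n)) Filter.atTop
      (𝓝 (normPowOn N p g (⋃ n, A n))) := by
  have h1 := hN.fatou (fun n => (A n).indicator g) ((⋃ n, A n).indicator g)
    (fun n => hg.1.indicator (hA n)) (hg.1.indicator (MeasurableSet.iUnion hA))
    (fun n x => Set.indicator_nonneg (fun y _ => hg0 y) x)
    (fun i j hij x => Set.indicator_le_indicator_of_subset (hmono hij) hg0 x)
    (fun x => (hmono.tendsto_indicator A g x).mono_right (pure_le_nhds _))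
  refine (ENNReal.tendsto_toReal ?_).comp
    ((ENNReal.continuous_rpow_const (y := p)).continuousAt.tendsto.comp h1)
  exact (ENNReal.rpow_lt_top_of_nonneg hp.le
    (hN.indicator_mem hg (MeasurableSet.iUnion hA)).2.ne).ne

theorem normPowOn_eq_zero_iff (hN : IsAdmissibleQuasinorm N) (hp : 0 < p) {g : Ω → ℝ}
    (hg : g ∈ functionSpace N) {A : Set Ω} (hA : MeasurableSet A) :
    normPowOn N p g A = 0 ↔ N (A.indicator g) = 0 := by
  have hfin := (hN.indicator_mem hg hA).2.ne
  rw [normPowOn, ENNReal.toReal_eq_zero_iff, ENNReal.rpow_eq_zero_iff, ENNReal.rpow_eq_top_iff]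
  simp [hp, hfin, hp.not_gt]

/-- By the Fatou property, whether the norm of a function vanishes depends only on its support. -/
theorem norm_eq_zero_iff_indicator_support (hN : IsAdmissibleQuasinorm N) {u f : Ω → ℝ}
    (hu : Measurable u) (hu0 : ∀ x, 0 < u x) (hf : Measurable f) :
    N f = 0 ↔ N ((Function.support f).indicator u) = 0 := by
  have hzero : ∀ (a : ℝ) (h : Ω → ℝ), Measurable h → N h = 0 → N (a • h) = 0 := by
    intro a h hh h0
    rw [hN.smul a h hh, h0, mul_zero]
  have hS : MeasurableSet (Function.support f) := measurableSet_support hf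
  have huS : Measurable ((Function.support f).indicator u) := hu.indicator hS
  have huSnn : ∀ x, 0 ≤ (Function.support f).indicator u x :=
    Set.indicator_nonneg fun y _ => (hu0 y).le
  -- For `h, h' ≥ 0` with `h' > 0` on the support of `h`, the functions `min h (n h')` increase
  -- to `h`.
  have key : ∀ h h' : Ω → ℝ, Measurable h → Measurable h' → (∀ x, 0 ≤ h x) → (∀ x, 0 ≤ h' x) →
      (∀ x, h x ≠ 0 → 0 < h' x) → N h' = 0 → N h = 0 := by
    intro h h' hh hh' hnn hnn' hsupp h0
    have hmeas : ∀ n : ℕ, Measurable fun x => min (h x) (n * h' x) :=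
      fun n => hh.min (hh'.const_mul _)
    have hnull : ∀ n : ℕ, N (fun x => min (h x) (n * h' x)) = 0 := by
      intro n
      refine le_antisymm ((hN.mono _ ((n : ℝ) • h') (hmeas n) (hh'.const_smul _)
        fun x => ?_).trans_eq (hzero n h' hh' h0)) zero_le
      have h1 : 0 ≤ (n : ℝ) * h' x := mul_nonneg (Nat.cast_nonneg n) (hnn' x)
      rw [abs_of_nonneg (le_min (hnn x) h1), Pi.smul_apply, smul_eq_mul, abs_of_nonneg h1]
      exact min_le_right _ _
    have hlim := hN.fatou (fun (n : ℕ) x => min (h x) (n * h' x)) h hmeas hh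
      (fun n x => le_min (hnn x) (mul_nonneg (Nat.cast_nonneg n) (hnn' x)))
      (fun m n hmn x => min_le_min_left _
        (mul_le_mul_of_nonneg_right (Nat.cast_le.2 hmn) (hnn' x)))
      (fun x => by
        refine tendsto_const_nhds.congr' ?_
        rcases eq_or_ne (h x) 0 with hx | hx
        · refine Filter.Eventually.of_forall fun n => ?_
          rw [hx]
          exact (min_eq_left (mul_nonneg (Nat.cast_nonneg n) (hnn' x))).symm
        · obtain ⟨n₀, hn₀⟩ := exists_nat_ge (h x / h' x)
          rw [div_le_iff₀ (hsupp x hx)] at hn₀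
          refine Filter.eventually_atTop.2 ⟨n₀, fun n hn => ?_⟩
          refine (min_eq_left (hn₀.trans ?_)).symm
          exact mul_le_mul_of_nonneg_right (Nat.cast_le.2 hn) (hnn' x))
    simp only [hnull] at hlim
    exact tendsto_nhds_unique hlim tendsto_const_nhds
  have habs : N f = N fun x => |f x| :=
    le_antisymm (hN.mono _ _ hf hf.abs fun x => by simp) (hN.mono _ _ hf.abs hf fun x => by simp)
  rw [habs]
  constructor
  · refine key _ _ huS hf.abs huSnn (fun x => abs_nonneg _) fun x hx => ?_
    exact abs_pos.2 (Set.mem_of_indicator_ne_zero hx)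
  · refine key _ _ hf.abs huS (fun x => abs_nonneg _) huSnn fun x hx => ?_
    rw [Set.indicator_of_mem (show x ∈ Function.support f from abs_ne_zero.1 hx)]
    exact hu0 x

theorem exists_control_measure (hN : IsAdmissibleQuasinorm N) (hp : 0 < p) (hq : 0 < q)
    (hpN : IsPNormable N p) (hqN : HasCrudeLowerEstimate N q) :
    ∃ μ : Measure Ω, IsFiniteMeasure μ ∧
      ∀ f : Ω → ℝ, Measurable f → (N f = 0 ↔ ∀ᵐ x ∂μ, f x = 0) := by
  obtain ⟨K, B, hK, hB, hφ⟩ := exists_isLowerSubmeasure_normPowOn hN hp hq hpN hqN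
  have ht : 0 < q / p := div_pos hq hp
  obtain ⟨c, hc, hcov⟩ := IsLowerSubmeasure.exists_le_sum_of_one_le (Ω := Ω) hK hB ht
  obtain ⟨u, hum, hu0, _, hufin⟩ := hN.exists_unit
  have hu : u ∈ functionSpace N := ⟨hum, hufin⟩
  obtain ⟨μ, hμfin, hμ⟩ := (hφ u hu).exists_finite_measure_null_iff ht hc (by
    intro S hS
    set g := S.indicator u with hg
    have hgX : g ∈ functionSpace N := hN.indicator_mem hu hS
    have hg0 : ∀ x, 0 ≤ g x := Set.indicator_nonneg fun y _ => (hu0 y).le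
    have hgφ : ∀ A, normPowOn N p g A = normPowOn N p u (A ∩ S) := by
      intro A
      rw [normPowOn, normPowOn, hg, Set.indicator_indicator]
    have h := hφ g hgX
    obtain ⟨μ, hμle, hμuniv⟩ := h.exists_measure_le_of_continuous
      (mul_nonneg hc.le (h.nonneg Set.univ))
      (by
        rintro _ ⟨ι, _, A, w, hA, hw, hcover, rfl⟩
        exact hcov _ h A w hA hw hcover)
      fun A hA hanti hempty => h.tendsto_zero_of_antitone ht
        (fun A hA hmono => tendsto_normPowOn_of_monotone hN hp hgX hg0 A hA hmono)
        hA hanti hempty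
    refine ⟨μ, fun A hA => (hμle A hA).trans (ENNReal.ofReal_le_ofReal ?_), ?_⟩
    · rw [hgφ]
      exact (hφ u hu).mono _ _ (hA.inter hS) hA Set.inter_subset_left
    · have h1 : μ Sᶜ = 0 := by
        have := hμle Sᶜ hS.compl
        rw [hgφ, Set.compl_inter_self, (hφ u hu).empty, ENNReal.ofReal_zero] at this
        exact le_antisymm this zero_le
      have h2 : μ S = μ Set.univ := by
        rw [← measure_add_measure_compl hS, h1, add_zero]
      rw [h2, hμuniv, hgφ, Set.univ_inter])
  refine ⟨μ, hμfin, fun f hf => ?_⟩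
  have hS : MeasurableSet (Function.support f) := measurableSet_support hf
  rw [norm_eq_zero_iff_indicator_support hN hum hu0 hf, ← normPowOn_eq_zero_iff hN hp hu hS,
    ← hμ _ hS, ae_iff]
  rfl

end ControlMeasure

theorem theorem3p2 {Ω : Type*} [TopologicalSpace Ω] [CompactSpace Ω] [T2Space Ω]
    [MeasurableSpace Ω] [BorelSpace Ω]
    (N : (Ω → ℝ) → ℝ≥0∞) (hN : IsAdmissibleQuasinorm N)
    (p q : ℝ) (hp : 0 < p) (hq : 0 < q)
    (hpN : IsPNormable N p) (hqN : HasCrudeLowerEstimate N q) :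
    (∀ r : ℝ, 0 < r → r < p → IsRConvex N r) ∧
    ∃ μ : MeasureTheory.Measure Ω, MeasureTheory.IsFiniteMeasure μ ∧
      ∀ f : Ω → ℝ, Measurable f → (N f = 0 ↔ ∀ᵐ x ∂μ, f x = 0) :=
  ⟨fun _ hr hrp => isRConvex_of_lt hN hp hq hpN hqN hr hrp,
    exists_control_measure hN hp hq hpN hqN⟩
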